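/- **Model (crash-restart-rollback, $\mathsf{CRR}$).** An asynchronous message-passing system has $n$ replicas and a finite but unbounded number of clients. An *implementation* consists of an automaton for every replica and every client; an atomic action is triggered by an operation invocation (clients only), the receipt of a message, a spontaneous local step, or a restart (replicas only); it updates the local state and sends finitely many messages, and a client action may return a response. Clients can only crash permanently. The state of a replica has a volatile and a non-volatile part. A replica may crash and later restart; it then resumes, via its restart handler, from the content of its non-volatile storage alone, and this content may have been reverted, undetectably, to one that the storage held at an earlier time and that differs from its content at the crash (a *rollback*). A replica is *down* while it has crashed and not yet restarted, and *up* otherwise. It is *correct* if it is up from some time on and never rolls back, and *faulty* otherwise; a faulty replica is *rollback-faulty* if it rolls back at least once; a correct replica is *benign* if it crashes at least once. Links are authenticated: a message is delivered at most once, only if it was sent, with the true sender, after an arbitrary delay, or never. An execution is *fair* if every process that is up from some time on takes infinitely many local steps and, whenever two processes are both up at all times from some time $T$ on, every message sent by one to the other from time $T$ on is eventually delivered. **Correctness.** Fix a set $V$ of values with at least two elements and an initial value $v_0\in V$. A multi-writer/multi-reader (MWMR) register supports the operations $\mathtt{read}()$ and $\mathtt{write}(v)$, $v \in V$, which any client may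 invoke, one at a time. For thresholds $k,r,b$, an implementation is a *$k$-tolerant implementation of a wait-free atomic MWMR register for $\mathsf{CRR}$* if, in every execution in which at most $k$ replicas are faulty, at most $r$ are rollback-faulty, at most $b$ are benign and any number of clients crash, responses are returned only to pending operations, every finite history is linearizable with respect to a register initialized to $v_0$, and, if the execution is fair, every operation invoked by a client that never crashes returns. Here always $r\le k$ and $b\le n$. The implementation may depend on $n$, $k$ and those of the thresholds $r,b$ that are *known*; if $r$ (respectively $b$) is *unknown*, a single implementation must be $k$-tolerant for all $r\le k$ (respectively all $b\le n$). **Corollary.** Let $n,k\ge 0$, and suppose that at least one of $r$ and $b$ is unknown. Put $r := k$ if $r$ is unknown and $b := n$ if $b$ is unknown. Then there exists a $k$-tolerant implementation of a wait-free atomic MWMR register for $\mathsf{CRR}$ with $n$ replicas if and only if $n \ge 2k+\min(b,r)+1$. Explicitly: 1. ($r$ unknown, $b\le n$ known) for each $b \le n$: there is one implementation that is $k$-tolerant for every $r\le k$ iff $n\ge 2k+\min(b,k)+1$; 2. ($b$ unknown, $r\le k$ known) for each $r \le k$: there is one implementation that is $k$-tolerant for every $b\le n$ iff $n\ge 2k+\min(n,r)+1$;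 3. (both unknown) there is one implementation that is $k$-tolerant for every $r\le k$ and every $b\le n$ iff $n\ge 2k+\min(n,k)+1$. -/

import Mathlib

namespace CRR

/-- The processes: `n` replicas, and clients named by natural numbers. Clients are finite but
unbounded in number: each run has its own finite set of clients (`Run.clients`). -/
inductive Proc (n : ℕ) : Type
  | replica (i : Fin n)
  | client (c : ℕ)

/-- The operations of a read/write register. -/
inductive RegOp (V : Type) : Type
  | read
  | write (v : V)

/-- The responses of a read/write register. -/
inductive RegResp (V : Type) : Type
  | ack
  | value (v : V)

/-- What triggers an atomic action of a process: receipt of a message, together with the identity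
of its sender (links are authenticated), or a spontaneous local step. -/
inductive Input (n : ℕ) (Msg : Type) : Type
  | recv (src : Proc n) (m : Msg)
  | tick

/-- An implementation of a register over `n` replicas: a composition of (possibly nondeterministic)
client and replica automata. An action changes the local state and sends a finite list of addressed
messages; an action of a client may also return a response to the operation being executed.
The state of a replica has a volatile part and a non-volatile part. A restarting replica has only
its non-volatile storage; `replicaRestart` gives the state in which it resumes, that is, in which
its restart handler has run or (for handlers that communicate) starts to run. -/
structure RegImpl (n : ℕ) (V : Type) : Type 1 where
  Msg : Type
  Vol : Type
  NonVol : Type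
  Cl : Type
  replicaStart : Fin n → Vol × NonVol
  clientStart : ℕ → Cl
  replicaStep : Fin n → Vol × NonVol → Input n Msg → Set ((Vol × NonVol) × List (Proc n × Msg))
  replicaRestart : Fin n → NonVol → Set (Vol × NonVol)
  clientInvoke : ℕ → Cl → RegOp V → Set (Cl × List (Proc n × Msg))
  clientStep : ℕ → Cl → Input n Msg → Set (Cl × List (Proc n × Msg) × Option (RegResp V))
  replicaStep_nonempty : ∀ i st inp, (replicaStep i st inp).Nonempty
  replicaRestart_nonempty : ∀ i nv, (replicaRestart i nv).Nonempty
  clientInvoke_nonempty : ∀ c st op, (clientInvoke c st op).Nonempty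
  clientStep_nonempty : ∀ c st inp, (clientStep c st inp).Nonempty

/-- A message in the network. -/
structure Packet (n : ℕ) (Msg : Type) : Type where
  src : Proc n
  dst : Proc n
  msg : Msg

/-- What happens at one point of (discrete) time. -/
inductive Event (n : ℕ) (V : Type) : Type
  /-- nothing happens -/
  | idle
  /-- a local step of `p` -/
  | tick (p : Proc n)
  /-- the `j`-th message sent at time `s` is delivered -/
  | deliver (s j : ℕ)
  /-- client `c` invokes `op` -/
  | invoke (c : ℕ) (op : RegOp V)
  | crash (p : Proc n)
  /-- replica `i` restarts with its non-volatile storage intact -/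
  | restart (i : Fin n)
  /-- replica `i` restarts with its non-volatile storage reverted to its content at time `s` -/
  | rollback (i : Fin n) (s : ℕ)

/-- A run: the local states at each time, the event at each time, the messages it sends, and the
response (with the client receiving it) that it returns, if any. -/
structure Run {n : ℕ} {V : Type} (A : RegImpl n V) : Type where
  clients : Finset ℕ
  rep : ℕ → Fin n → A.Vol × A.NonVol
  cl : ℕ → ℕ → A.Cl
  ev : ℕ → Event n V
  sent : ℕ → List (Packet n A.Msg)
  resp : ℕ → Option (ℕ × RegResp V)

namespace Run

variable {n : ℕ} {V : Type} {A : RegImpl n V} (e : Run A)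

/-- The process takes part in the run. -/
def Present : Proc n → Prop
  | .replica _ => True
  | .client c => c ∈ e.clients

/-- `p` restarts at time `t`, with or without rollback. Clients never do. -/
def RestartsAt (p : Proc n) (t : ℕ) : Prop :=
  ∃ i, p = .replica i ∧ (e.ev t = .restart i ∨ ∃ s, e.ev t = .rollback i s)

/-- `p` has crashed before `t` and has not restarted since. -/
def DownAt (p : Proc n) (t : ℕ) : Prop :=
  ∃ t', t' < t ∧ e.ev t' = .crash p ∧ ∀ s, t' < s → s < t → ¬ e.RestartsAt p s

def UpAt (p : Proc n) (t : ℕ) : Prop := ¬ e.DownAt p t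

/-- Client `c` has, before time `t`, invoked an operation that has not returned before `t`. -/
def PendingAt (c t : ℕ) : Prop :=
  ∃ t', t' < t ∧ (∃ op, e.ev t' = .invoke c op) ∧
    ∀ s, t' < s → s < t → ∀ ρ, e.resp s ≠ some (c, ρ)

/-- Process `p` takes, at time `t`, an atomic action triggered by `inp`. -/
def Acts (t : ℕ) (p : Proc n) (inp : Input n A.Msg) : Prop :=
  match p with
  | .replica i => ∃ st out, (st, out) ∈ A.replicaStep i (e.rep t i) inp ∧
      e.rep (t + 1) = Function.update (e.rep t) i st ∧ e.cl (t + 1) = e.cl t ∧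
      e.sent t = out.map (fun d => ⟨.replica i, d.1, d.2⟩) ∧ e.resp t = none
  | .client c => ∃ st out ρ, (st, out, ρ) ∈ A.clientStep c (e.cl t c) inp ∧
      e.rep (t + 1) = e.rep t ∧ e.cl (t + 1) = Function.update (e.cl t) c st ∧
      e.sent t = out.map (fun d => ⟨.client c, d.1, d.2⟩) ∧ e.resp t = ρ.map (fun x => (c, x))

/-- At time `t`, nothing is sent, nothing is returned, and no client changes its state. -/
def Quiet (t : ℕ) : Prop :=
  e.cl (t + 1) = e.cl t ∧ e.sent t = [] ∧ e.resp t = none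

/-- The transition at time `t` is one that the automata, the links and the failure model allow.
Links are asynchronous: they deliver only messages that have been sent, each at most once, in any
order and after any delay. -/
def ValidStep (t : ℕ) : Prop :=
  match e.ev t with
  | .idle => e.rep (t + 1) = e.rep t ∧ e.Quiet t
  | .tick p => e.Present p ∧ e.UpAt p t ∧ e.Acts t p .tick
  | .deliver s j => ∃ pk : Packet n A.Msg, s < t ∧ (e.sent s)[j]? = some pk ∧
      (∀ t' < t, e.ev t' ≠ .deliver s j) ∧
      e.Present pk.dst ∧ e.UpAt pk.dst t ∧ e.Acts t pk.dst (.recv pk.src pk.msg)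
  | .invoke c op => c ∈ e.clients ∧ e.UpAt (.client c) t ∧ ¬ e.PendingAt c t ∧
      ∃ st out, (st, out) ∈ A.clientInvoke c (e.cl t c) op ∧
        e.rep (t + 1) = e.rep t ∧ e.cl (t + 1) = Function.update (e.cl t) c st ∧
        e.sent t = out.map (fun d => ⟨.client c, d.1, d.2⟩) ∧ e.resp t = none
  | .crash p => e.Present p ∧ e.UpAt p t ∧ e.rep (t + 1) = e.rep t ∧ e.Quiet t
  | .restart i => e.DownAt (.replica i) t ∧ e.Quiet t ∧
      ∃ st ∈ A.replicaRestart i (e.rep t i).2, e.rep (t + 1) = Function.update (e.rep t) i st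
  | .rollback i s => e.DownAt (.replica i) t ∧ e.Quiet t ∧
      s < t ∧ (e.rep s i).2 ≠ (e.rep t i).2 ∧
      ∃ st ∈ A.replicaRestart i (e.rep s i).2, e.rep (t + 1) = Function.update (e.rep t) i st

/-- The run is an execution of the implementation. Finite executions are those that are idle from
some time on; liveness assumptions are in `Fair`. -/
def IsExecution : Prop :=
  e.rep 0 = A.replicaStart ∧ e.cl 0 = A.clientStart ∧ ∀ t, e.ValidStep t

/-! ### Failures -/

def EventuallyUp (p : Proc n) : Prop := ∃ T, ∀ t, T ≤ t → e.UpAt p t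

def RollsBack (i : Fin n) : Prop := ∃ t s, e.ev t = .rollback i s

/-- A replica is correct if it is eventually up and never rolls back. -/
def CorrectReplica (i : Fin n) : Prop := e.EventuallyUp (.replica i) ∧ ¬ e.RollsBack i

def Faulty (i : Fin n) : Prop := ¬ e.CorrectReplica i

def RollbackFaulty (i : Fin n) : Prop := e.Faulty i ∧ e.RollsBack i

/-- A correct replica is benign if it crashes at least once. -/
def Benign (i : Fin n) : Prop := e.CorrectReplica i ∧ ∃ t, e.ev t = .crash (.replica i)

/-- A client is correct if it never crashes. -/
def CorrectClient (c : ℕ) : Prop := c ∈ e.clients ∧ ∀ t, e.ev t ≠ .crash (.client c)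

/-- At most `k` replicas are faulty, at most `r` are rollback-faulty, at most `b` are benign.
Any number of clients may crash. -/
def WithinBounds (k r b : ℕ) : Prop :=
  {i | e.Faulty i}.ncard ≤ k ∧ {i | e.RollbackFaulty i}.ncard ≤ r ∧ {i | e.Benign i}.ncard ≤ b

/-- Fairness: a process that is permanently up from some time on takes infinitely many local steps,
and if two processes are both permanently up from time `T` on, then every message sent by one to the
other from time `T` on is eventually delivered. -/
def Fair : Prop :=
  (∀ p, e.Present p → e.EventuallyUp p → ∀ T, ∃ t, T ≤ t ∧ e.ev t = .tick p) ∧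
  (∀ p q, e.Present p → e.Present q →
    ∀ T, (∀ t, T ≤ t → e.UpAt p t ∧ e.UpAt q t) →
      ∀ s, T ≤ s → ∀ (j : ℕ) (m : A.Msg), (e.sent s)[j]? = some ⟨p, q, m⟩ →
        ∃ t, e.ev t = .deliver s j)

/-! ### Correctness of a register -/

/-- The operation invoked at time `a` returns at time `t` with response `ρ`. -/
def Returns (a t : ℕ) (ρ : RegResp V) : Prop :=
  ∃ c op, e.ev a = .invoke c op ∧ a < t ∧ e.resp t = some (c, ρ) ∧
    ∀ s, a < s → s < t → ∀ ρ', e.resp s ≠ some (c, ρ')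

/-- Executed one after another, starting from register content `v`, the operations invoked at the
times in the list produce the responses that they have returned before time `T`. -/
def Legal (T : ℕ) : V → List ℕ → Prop
  | _, [] => True
  | v, a :: l =>
    match e.ev a with
    | .invoke _ .read => (∀ t < T, ∀ ρ, e.Returns a t ρ → ρ = .value v) ∧ Legal T v l
    | .invoke _ (.write w) => (∀ t < T, ∀ ρ, e.Returns a t ρ → ρ = .ack) ∧ Legal T w l
    | _ => False

/-- The history before time `T` is linearizable with respect to a register with initial value `v₀`.
Operations are identified by their times of invocation. The list has all operations that returned
before `T` and possibly some pending ones, and respects the real-time order. -/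
def LinearizableUpTo (v₀ : V) (T : ℕ) : Prop :=
  ∃ L : List ℕ, L.Nodup ∧ (∀ a ∈ L, a < T) ∧
    (∀ a, ∀ t < T, ∀ ρ, e.Returns a t ρ → a ∈ L) ∧
    L.Pairwise (fun a a' => ¬ ∃ t ρ, e.Returns a' t ρ ∧ t < a) ∧
    e.Legal T v₀ L

/-- Responses are returned only to pending operations, and every finite history is linearizable. -/
def Atomic (v₀ : V) : Prop :=
  (∀ t c ρ, e.resp t = some (c, ρ) → e.PendingAt c t) ∧ ∀ T, e.LinearizableUpTo v₀ T

/-- Every operation invoked by a correct client returns. -/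
def WaitFree : Prop :=
  ∀ c, e.CorrectClient c → ∀ a op, e.ev a = .invoke c op → ∃ t ρ, e.Returns a t ρ

end Run

/-- `A` is a `k`-tolerant implementation, in the crash-restart-rollback model, of a wait-free atomic
multi-writer/multi-reader register with initial value `v₀`, when at most `r` replicas can be
rollback-faulty and at most `b` replicas are benign. Every client may both read and write. -/
def RegImpl.KTolerant {n : ℕ} {V : Type} (A : RegImpl n V) (v₀ : V) (k r b : ℕ) : Prop :=
  ∀ e : Run A, e.IsExecution → e.WithinBounds k r b → e.Atomic v₀ ∧ (e.Fair → e.WaitFree)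

end CRR

/-!
The largest values of the unknown thresholds are the worst, so everything follows from the fact that,
for given `r ≤ k` and `b`, an implementation exists if and only if `n ≥ 2k + min b r + 1`.

*Sufficiency* (`exists_kTolerant`). An operation first queries a quorum of replicas for their latest
stamped values and then stores a stamped value at a quorum of `n - k` replicas: a write stores its
value with a larger stamp, a read writes back the latest value it has found. Linearizability
(`linearizableUpTo`) needs only that any store quorum and any query quorum share a replica that has
lost nothing when it answers the query (`QuorumsMeet`). There are two ways to ensure this.

* If `n ≥ 2k + r + 1`, then query quorums also have `n - k` replicas, and the common replicas are
  too many to all roll back (`quorumsMeet_of_rollbackFaulty`).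
* If `n ≥ 2k + b + 1`, then a replica that has restarted never again answers queries, while it still
  acknowledges stores. The at least `n - k - b` correct replicas that never crash form a query
  quorum, and whoever answers a query has never restarted, hence lost nothing
  (`quorumsMeet_of_lock`).

*Necessity* (`not_kTolerant`). If `n ≤ 2k + min b r`, the replicas are the union of `X` and `B`, of
size at most `k`, and `C`, of size at most `min b r`. A write returns in a fair run in which `X` has
crashed; a read returns the initial value in a fair run in which `B` has crashed and the replicas in
`C` have crashed and restarted (`exists_solo`). In the run that first follows the write, with `X`
merely slow, then rolls back `C` to its initial storage and follows the read, with `B` merely slow,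
only the replicas in `C` are faulty, but the read misses the write (`Spliceable.not_atomic`).
-/

namespace CRR

/-! ### The quorum protocol -/

/-- Logical time stamps, ordered lexicographically: a number and the name of the writing client. -/
abbrev Tag : Type := ℕ ×ₗ ℕ

/-- The messages of the protocol. The number `q` tells a client which of its operations a reply
belongs to. -/
inductive QMsg (V : Type) : Type
  | query (q : ℕ)
  | queryReply (q : ℕ) (x : Tag × V)
  | store (q : ℕ) (x : Tag × V)
  | storeAck (q : ℕ)

/-- What a client is doing. While querying it keeps the latest stamped value it has heard of and the
replicas it has heard from; while storing it keeps the stamped value and the replicas that have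
acknowledged it. -/
inductive Phase (n : ℕ) (V : Type) : Type
  | idle
  | query (op : RegOp V) (best : Tag × V) (heard : Finset (Fin n))
  | store (op : RegOp V) (x : Tag × V) (acked : Finset (Fin n))

/-- The state of a client: the number of operations it has invoked so far, and its phase. -/
structure ClientState (n : ℕ) (V : Type) : Type where
  count : ℕ
  phase : Phase n V

variable {n : ℕ} {V : Type}

/-- The one of two stamped values with the larger tag, the first one in case of a tie. -/
def later (x y : Tag × V) : Tag × V := if x.1 < y.1 then y else x

lemma le_later_left (x y : Tag × V) : x.1 ≤ (later x y).1 := by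
  unfold later; split_ifs with h
  exacts [h.le, le_rfl]

lemma le_later_right (x y : Tag × V) : y.1 ≤ (later x y).1 := by
  unfold later; split_ifs with h
  exacts [le_rfl, not_lt.1 h]

lemma later_eq_or (x y : Tag × V) : later x y = x ∨ later x y = y := by
  unfold later; split_ifs <;> simp

/-- The stamped value that an operation of client `c` stores after its query phase: a read writes
back what it has found, a write uses a larger tag. -/
def newStamp (c : ℕ) : RegOp V → Tag × V → Tag × V
  | .read, x => x
  | .write v, x => (toLex ((ofLex x.1).1 + 1, c), v)

lemma le_newStamp (c : ℕ) (op : RegOp V) (x : Tag × V) : x.1 ≤ (newStamp c op x).1 := by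
  cases op with
  | read => exact le_rfl
  | write v => exact (Prod.Lex.lt_iff.2 (Or.inl (Nat.lt_succ_self _))).le

lemma lt_newStamp_write (c : ℕ) (v : V) (x : Tag × V) : x.1 < (newStamp c (.write v) x).1 :=
  Prod.Lex.lt_iff.2 (Or.inl (Nat.lt_succ_self _))

/-- The response of an operation that has stored `x`. -/
def response : RegOp V → Tag × V → RegResp V
  | .read, x => .value x.2
  | .write _, _ => .ack

/-- The action of a replica. Its volatile state is a flag: when set, the replica is muted, that is,
it does not answer queries. It still stores and acknowledges. -/
def replicaReact (st : Bool × (Tag × V)) :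
    Input n (QMsg V) → (Bool × (Tag × V)) × List (Proc n × QMsg V)
  | .recv src (.query q) => (st, if st.1 then [] else [(src, .queryReply q st.2)])
  | .recv src (.store q x) => ((st.1, later st.2 x), [(src, .storeAck q)])
  | _ => (st, [])

/-- A message to all replicas. -/
def broadcast (m : QMsg V) : List (Proc n × QMsg V) :=
  (List.finRange n).map fun i => (.replica i, m)

/-- The action of client `c`. Replies are only recorded on receipt; phases are ended, and requests
sent and sent again, in local steps. -/
def clientReact (qr qw c : ℕ) (st : ClientState n V) :
    Input n (QMsg V) → ClientState n V × List (Proc n × QMsg V) × Option (RegResp V)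
  | .tick =>
    match st.phase with
    | .idle => (st, [], none)
    | .query op best heard =>
      if qr ≤ heard.card then (⟨st.count, .store op (newStamp c op best) ∅⟩, [], none)
      else (st, broadcast (.query st.count), none)
    | .store op x acked =>
      if qw ≤ acked.card then (⟨st.count, .idle⟩, [], some (response op x))
      else (st, broadcast (.store st.count x), none)
  | .recv (.replica i) (.queryReply q y) =>
    match st.phase with
    | .query op best heard =>
      if q = st.count then (⟨st.count, .query op (later best y) (insert i heard)⟩, [], none)
      else (st, [], none)
    | _ => (st, [], none)
  | .recv (.replica i) (.storeAck q) =>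
    match st.phase with
    | .store op x acked =>
      if q = st.count then (⟨st.count, .store op x (insert i acked)⟩, [], none)
      else (st, [], none)
    | _ => (st, [], none)
  | _ => (st, [], none)

/-- The register protocol with query quorums of size `qr` and store quorums of size `qw`. The
stamped value of a replica is non-volatile. If `lock` is true, then a replica that restarts is muted
from then on; otherwise no replica is ever muted. -/
abbrev quorumRegister (n : ℕ) (V : Type) (v₀ : V) (lock : Bool) (qr qw : ℕ) : RegImpl n V where
  Msg := QMsg V
  Vol := Bool
  NonVol := Tag × V
  Cl := ClientState n V
  replicaStart _ := (false, (toLex (0, 0), v₀))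
  clientStart _ := ⟨0, .idle⟩
  replicaStep _ st inp := {replicaReact st inp}
  replicaRestart _ nv := {(lock, nv)}
  clientInvoke _ st op := {(⟨st.count + 1, .query op (toLex (0, 0), v₀) ∅⟩, [])}
  clientStep c st inp := {clientReact qr qw c st inp}
  replicaStep_nonempty _ _ _ := Set.singleton_nonempty _
  replicaRestart_nonempty _ _ := Set.singleton_nonempty _
  clientInvoke_nonempty _ _ _ := Set.singleton_nonempty _
  clientStep_nonempty _ _ _ := Set.singleton_nonempty _

/-! ### Single steps of the protocol -/

variable {v₀ : V} {lock : Bool} {qr qw : ℕ}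

/-- The stamped value of replica `i` at time `t`. -/
def stamp (e : Run (quorumRegister n V v₀ lock qr qw)) (t : ℕ) (i : Fin n) : Tag × V := (e.rep t i).2

/-- Whether replica `i` is muted at time `t`. -/
def muted (e : Run (quorumRegister n V v₀ lock qr qw)) (t : ℕ) (i : Fin n) : Bool := (e.rep t i).1

/-- The state of client `c` at time `t`. -/
def client (e : Run (quorumRegister n V v₀ lock qr qw)) (t c : ℕ) : ClientState n V := e.cl t c

variable {e : Run (quorumRegister n V v₀ lock qr qw)}

/-- The ways in which the state of client `c` may change at time `t`. -/
inductive ClientMove (e : Run (quorumRegister n V v₀ lock qr qw)) (c t : ℕ) : Prop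
  | stay (hst : client e (t + 1) c = client e t c) (hr : ∀ ρ, e.resp t ≠ some (c, ρ))
  | invoke (op : RegOp V) (hev : e.ev t = .invoke c op)
      (hst : client e (t + 1) c =
        ⟨(client e t c).count + 1, .query op (toLex (0, 0), v₀) ∅⟩) (hr : e.resp t = none)
  | hear (op : RegOp V) (best : Tag × V) (heard : Finset (Fin n)) (i : Fin n) (y : Tag × V) (s : ℕ)
      (h0 : (client e t c).phase = .query op best heard) (hs : s < t)
      (hpk : ⟨.replica i, .client c, .queryReply (client e t c).count y⟩ ∈ e.sent s)
      (hst : client e (t + 1) c =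
        ⟨(client e t c).count, .query op (later best y) (insert i heard)⟩) (hr : e.resp t = none)
  | commit (op : RegOp V) (best : Tag × V) (heard : Finset (Fin n))
      (h0 : (client e t c).phase = .query op best heard) (hq : qr ≤ heard.card)
      (hst : client e (t + 1) c = ⟨(client e t c).count, .store op (newStamp c op best) ∅⟩)
      (hr : e.resp t = none)
  | ack (op : RegOp V) (x : Tag × V) (acked : Finset (Fin n)) (i : Fin n) (s : ℕ)
      (h0 : (client e t c).phase = .store op x acked) (hs : s < t)
      (hpk : ⟨.replica i, .client c, .storeAck (client e t c).count⟩ ∈ e.sent s)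
      (hst : client e (t + 1) c = ⟨(client e t c).count, .store op x (insert i acked)⟩)
      (hr : e.resp t = none)
  | finish (op : RegOp V) (x : Tag × V) (acked : Finset (Fin n))
      (h0 : (client e t c).phase = .store op x acked) (hq : qw ≤ acked.card)
      (hst : client e (t + 1) c = ⟨(client e t c).count, .idle⟩)
      (hr : e.resp t = some (c, response op x))

lemma acts_client {t c : ℕ} {inp : Input n (QMsg V)} (h : e.Acts t (.client c) inp) :
    client e (t + 1) c = (clientReact qr qw c (client e t c) inp).1 ∧
    e.rep (t + 1) = e.rep t ∧
    e.sent t = (clientReact qr qw c (client e t c) inp).2.1.map (fun d => ⟨.client c, d.1, d.2⟩) ∧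
    e.resp t = (clientReact qr qw c (client e t c) inp).2.2.map (fun x => (c, x)) := by
  obtain ⟨st, out, ρ, hm, h1, h2, h3, h4⟩ := h
  rw [Set.mem_singleton_iff] at hm
  unfold client
  rw [← hm]
  exact ⟨by rw [h2]; simp, h1, h3, h4⟩

lemma acts_replica {t : ℕ} {i : Fin n} {inp : Input n (QMsg V)} (h : e.Acts t (.replica i) inp) :
    e.rep (t + 1) = Function.update (e.rep t) i (replicaReact (e.rep t i) inp).1 ∧
    e.cl (t + 1) = e.cl t ∧
    e.sent t = (replicaReact (e.rep t i) inp).2.map (fun d => ⟨.replica i, d.1, d.2⟩) ∧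
    e.resp t = none := by
  obtain ⟨st, out, hm, h1, h2, h3, h4⟩ := h
  rw [Set.mem_singleton_iff] at hm
  rw [← hm]
  exact ⟨h1, h2, h3, h4⟩

lemma acts_client_other {t c : ℕ} {p : Proc n} {inp : Input n (QMsg V)} (h : e.Acts t p inp)
    (hp : p ≠ .client c) : client e (t + 1) c = client e t c ∧ ∀ ρ, e.resp t ≠ some (c, ρ) := by
  cases p with
  | replica i =>
    obtain ⟨-, h2, -, h4⟩ := acts_replica h
    exact ⟨by unfold client; rw [h2], by simp [h4]⟩
  | client c' =>
    have hc : c ≠ c' := fun h => hp (by rw [h])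
    obtain ⟨st, out, ρ, hm, h1, h2, h3, h4⟩ := h
    refine ⟨by unfold client; rw [h2, Function.update_of_ne hc], fun ρ' h' => ?_⟩
    rw [h4] at h'
    cases ρ <;> simp at h'
    exact hc h'.1.symm

lemma client_move (he : e.IsExecution) (c t : ℕ) : ClientMove e c t := by
  have hv := he.2.2 t
  have quiet : e.Quiet t → ClientMove e c t := fun h =>
    .stay (by unfold client; rw [h.1]) (by simp [h.2.2])
  unfold Run.ValidStep at hv
  cases hev : e.ev t with
  | idle => rw [hev] at hv; exact quiet hv.2
  | crash p => rw [hev] at hv; exact quiet hv.2.2.2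
  | restart i => rw [hev] at hv; exact quiet hv.2.1
  | rollback i s => rw [hev] at hv; exact quiet hv.2.1
  | invoke c' op =>
    rw [hev] at hv
    obtain ⟨-, -, -, st, out, hm, -, h2, -, h4⟩ := hv
    rw [Set.mem_singleton_iff] at hm
    by_cases hc : c = c'
    · subst hc
      refine .invoke op hev ?_ h4
      unfold client
      rw [h2, Function.update_self]
      exact congrArg Prod.fst hm
    · exact .stay (by unfold client; rw [h2, Function.update_of_ne hc]) (by simp [h4])
  | tick p =>
    rw [hev] at hv
    by_cases hp : p = .client c
    · subst hp
      obtain ⟨h1, -, -, h3⟩ := acts_client hv.2.2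
      simp only [clientReact] at h1 h3
      cases hph : (client e t c).phase with
      | idle => simp only [hph] at h1 h3; exact .stay h1 (by simp [h3])
      | query op best heard =>
        simp only [hph] at h1 h3
        by_cases hq : qr ≤ heard.card
        · simp only [hq, if_true] at h1 h3
          exact .commit op best heard hph hq h1 h3
        · simp only [hq, if_false] at h1 h3
          exact .stay h1 (by simp [h3])
      | store op x acked =>
        simp only [hph] at h1 h3
        by_cases hq : qw ≤ acked.card
        · simp only [hq, if_true] at h1 h3
          exact .finish op x acked hph hq h1 h3
        · simp only [hq, if_false] at h1 h3
          exact .stay h1 (by simp [h3])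
    · have := acts_client_other hv.2.2 hp
      exact .stay this.1 this.2
  | deliver s j =>
    rw [hev] at hv
    obtain ⟨⟨src, dst, m⟩, hs, hj, -, -, -, ha⟩ := hv
    have hmem := List.mem_of_getElem? hj
    dsimp only at ha
    by_cases hp : dst = .client c
    · subst hp
      obtain ⟨h1, -, -, h3⟩ := acts_client ha
      have stay : clientReact qr qw c (client e t c) (.recv src m) = (client e t c, [], none) →
          ClientMove e c t := fun h => by
        rw [h] at h1 h3; exact .stay h1 (by simp [h3])
      rcases src with i | c'
      · rcases m with q | ⟨q, y⟩ | ⟨q, x⟩ | q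
        · exact stay rfl
        · cases hph : (client e t c).phase with
          | query op best heard =>
            by_cases hq : q = (client e t c).count
            · simp only [clientReact, hph, hq, if_true] at h1 h3
              rw [hq] at hmem
              exact .hear op best heard i y s hph hs hmem h1 h3
            · exact stay (by simp [clientReact, hph, hq])
          | _ => exact stay (by simp [clientReact, hph])
        · exact stay rfl
        · cases hph : (client e t c).phase with
          | store op x acked =>
            by_cases hq : q = (client e t c).count
            · simp only [clientReact, hph, hq, if_true] at h1 h3
              rw [hq] at hmem
              exact .ack op x acked i s hph hs hmem h1 h3
            · exact stay (by simp [clientReact, hph, hq])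
          | _ => exact stay (by simp [clientReact, hph])
      · exact stay (by rcases m with q | ⟨q, y⟩ | ⟨q, x⟩ | q <;> rfl)
    · have := acts_client_other ha hp
      exact .stay this.1 this.2

/-- A packet is sent by the process that acts. -/
lemma acts_of_mem_sent (he : e.IsExecution) {t : ℕ} {pk : Packet n (QMsg V)} (h : pk ∈ e.sent t) :
    (e.ev t = .tick pk.src ∧ e.Acts t pk.src .tick) ∨
    ∃ s < t, ∃ src m, ⟨src, pk.src, m⟩ ∈ e.sent s ∧ e.Acts t pk.src (.recv src m) := by
  have hv := he.2.2 t
  have quiet : e.Quiet t → False := fun h' => by rw [h'.2.1] at h; simp at h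
  have key : ∀ p inp, e.Acts t p inp → pk.src = p := by
    intro p inp ha
    cases p with
    | replica i =>
      obtain ⟨-, -, h3, -⟩ := acts_replica ha
      rw [h3, List.mem_map] at h
      obtain ⟨d, -, rfl⟩ := h; rfl
    | client c =>
      obtain ⟨-, -, h3, -⟩ := acts_client ha
      rw [h3, List.mem_map] at h
      obtain ⟨d, -, rfl⟩ := h; rfl
  unfold Run.ValidStep at hv
  cases hev : e.ev t with
  | idle => rw [hev] at hv; exact (quiet hv.2).elim
  | crash p => rw [hev] at hv; exact (quiet hv.2.2.2).elim
  | restart i => rw [hev] at hv; exact (quiet hv.2.1).elim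
  | rollback i s => rw [hev] at hv; exact (quiet hv.2.1).elim
  | invoke c' op =>
    rw [hev] at hv
    obtain ⟨-, -, -, st, out, hm, -, -, h3, -⟩ := hv
    rw [Set.mem_singleton_iff] at hm
    rw [h3, (Prod.mk.inj hm).2] at h
    simp at h
  | tick p =>
    rw [hev] at hv
    rw [key p _ hv.2.2]
    exact Or.inl ⟨rfl, hv.2.2⟩
  | deliver s j =>
    rw [hev] at hv
    obtain ⟨⟨src, dst, m⟩, hs, hj, -, -, -, ha⟩ := hv
    rw [key dst _ ha]
    exact Or.inr ⟨s, hs, src, m, List.mem_of_getElem? hj, ha⟩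

lemma sent_by_client (he : e.IsExecution) {t c : ℕ} {d : Proc n} {m : QMsg V}
    (h : ⟨.client c, d, m⟩ ∈ e.sent t) :
    ((∃ op best heard, (client e t c).phase = .query op best heard) ∧
      m = .query (client e t c).count) ∨
    ∃ op x acked, (client e t c).phase = .store op x acked ∧ m = .store (client e t c).count x := by
  rcases acts_of_mem_sent he h with ⟨-, ha⟩ | ⟨s, -, src, m', -, ha⟩
  · obtain ⟨-, -, h3, -⟩ := acts_client ha
    rw [h3] at h
    simp only [clientReact] at h
    cases hph : (client e t c).phase with
    | idle => simp [hph] at h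
    | query op best heard =>
      rw [hph] at h; dsimp only at h
      split_ifs at h
      · simp at h
      · simp only [broadcast, List.map_map, List.mem_map] at h
        obtain ⟨i, -, hi⟩ := h
        simp only [Function.comp, Packet.mk.injEq] at hi
        exact Or.inl ⟨⟨_, _, _, rfl⟩, hi.2.2.symm⟩
    | store op x acked =>
      rw [hph] at h; dsimp only at h
      split_ifs at h
      · simp at h
      · simp only [broadcast, List.map_map, List.mem_map] at h
        obtain ⟨i, -, hi⟩ := h
        simp only [Function.comp, Packet.mk.injEq] at hi
        exact Or.inr ⟨_, _, _, rfl, hi.2.2.symm⟩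
  · obtain ⟨-, -, h3, -⟩ := acts_client ha
    have : (clientReact qr qw c (client e t c) (.recv src m')).2.1 = [] := by
      unfold clientReact
      rcases src with i | c' <;> rcases m' with q | ⟨q, y⟩ | ⟨q, x⟩ | q <;> try rfl
      all_goals dsimp only; split <;> try rfl
      all_goals split_ifs <;> rfl
    rw [h3, this] at h
    simp at h

lemma sent_queryReply (he : e.IsExecution) {t q : ℕ} {i : Fin n} {d : Proc n} {y : Tag × V}
    (h : ⟨.replica i, d, .queryReply q y⟩ ∈ e.sent t) :
    (∃ s < t, ⟨d, .replica i, .query q⟩ ∈ e.sent s) ∧ muted e t i = false ∧ y = stamp e t i := by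
  rcases acts_of_mem_sent he h with ⟨-, ha⟩ | ⟨s, hs, src, m', hm, ha⟩
  · obtain ⟨-, -, h3, -⟩ := acts_replica ha
    rw [h3] at h
    simp [replicaReact] at h
  · obtain ⟨-, -, h3, -⟩ := acts_replica ha
    rw [h3] at h
    rcases m' with q' | ⟨q', y'⟩ | ⟨q', x⟩ | q' <;> simp [replicaReact] at h
    obtain ⟨hmu, rfl, rfl, rfl⟩ := h
    exact ⟨⟨s, hs, hm⟩, hmu, rfl⟩

lemma sent_storeAck (he : e.IsExecution) {t q : ℕ} {i : Fin n} {d : Proc n}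
    (h : ⟨.replica i, d, .storeAck q⟩ ∈ e.sent t) :
    ∃ x : Tag × V, (∃ s < t, ⟨d, .replica i, .store q x⟩ ∈ e.sent s) ∧
      x.1 ≤ (stamp e (t + 1) i).1 := by
  rcases acts_of_mem_sent he h with ⟨-, ha⟩ | ⟨s, hs, src, m', hm, ha⟩
  · obtain ⟨-, -, h3, -⟩ := acts_replica ha
    rw [h3] at h
    simp [replicaReact] at h
  · obtain ⟨h1, -, h3, -⟩ := acts_replica ha
    rw [h3] at h
    rcases m' with q' | ⟨q', y'⟩ | ⟨q', x⟩ | q' <;> simp [replicaReact] at h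
    obtain ⟨rfl, rfl⟩ := h
    refine ⟨x, ⟨s, hs, hm⟩, ?_⟩
    unfold stamp
    rw [h1, Function.update_self]
    exact le_later_right _ _

/-- The ways in which the state of replica `i` may change at time `t`. -/
lemma replica_move (he : e.IsExecution) (i : Fin n) (t : ℕ) :
    (muted e (t + 1) i = muted e t i ∧ (stamp e (t + 1) i = stamp e t i ∨
      ∃ s < t, ∃ src q x, ⟨src, .replica i, .store q x⟩ ∈ e.sent s ∧
        stamp e (t + 1) i = later (stamp e t i) x)) ∨
    (e.ev t = .restart i ∧ muted e (t + 1) i = lock ∧ stamp e (t + 1) i = stamp e t i) ∨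
    ∃ s < t, e.ev t = .rollback i s ∧ muted e (t + 1) i = lock ∧
      stamp e (t + 1) i = stamp e s i := by
  have hv := he.2.2 t
  have stay : e.rep (t + 1) i = e.rep t i → (muted e (t + 1) i = muted e t i ∧
      (stamp e (t + 1) i = stamp e t i ∨
      ∃ s < t, ∃ src q x, ⟨src, .replica i, .store q x⟩ ∈ e.sent s ∧
        stamp e (t + 1) i = later (stamp e t i) x)) := fun h => by
    unfold muted stamp; rw [h]; exact ⟨rfl, Or.inl rfl⟩
  unfold Run.ValidStep at hv
  cases hev : e.ev t with
  | idle => rw [hev] at hv; exact Or.inl (stay (by rw [hv.1]))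
  | crash p => rw [hev] at hv; exact Or.inl (stay (by rw [hv.2.2.1]))
  | invoke c' op =>
    rw [hev] at hv
    obtain ⟨-, -, -, st, out, -, h1, -⟩ := hv
    exact Or.inl (stay (by rw [h1]))
  | restart i' =>
    rw [hev] at hv
    obtain ⟨-, -, st, hst, h1⟩ := hv
    by_cases hi : i = i'
    · subst hi
      rw [Set.mem_singleton_iff] at hst
      unfold muted stamp
      rw [h1, Function.update_self, hst]
      exact Or.inr (Or.inl ⟨rfl, rfl, rfl⟩)
    · exact Or.inl (stay (by rw [h1, Function.update_of_ne hi]))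
  | rollback i' s =>
    rw [hev] at hv
    obtain ⟨-, -, hs, -, st, hst, h1⟩ := hv
    by_cases hi : i = i'
    · subst hi
      rw [Set.mem_singleton_iff] at hst
      unfold muted stamp
      rw [h1, Function.update_self, hst]
      exact Or.inr (Or.inr ⟨s, hs, rfl, rfl, rfl⟩)
    · exact Or.inl (stay (by rw [h1, Function.update_of_ne hi]))
  | tick p =>
    rw [hev] at hv
    refine Or.inl ?_
    cases p with
    | client c => exact stay (by rw [(acts_client hv.2.2).2.1])
    | replica i' =>
      obtain ⟨h1, -⟩ := acts_replica hv.2.2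
      refine stay ?_
      rw [h1]
      by_cases hi : i = i'
      · subst hi; rw [Function.update_self]; rfl
      · rw [Function.update_of_ne hi]
  | deliver s j =>
    rw [hev] at hv
    obtain ⟨⟨src, dst, m⟩, hs, hj, -, -, -, ha⟩ := hv
    have hmem := List.mem_of_getElem? hj
    dsimp only at ha
    refine Or.inl ?_
    cases dst with
    | client c => exact stay (by rw [(acts_client ha).2.1])
    | replica i' =>
      obtain ⟨h1, -⟩ := acts_replica ha
      by_cases hi : i = i'
      · subst hi
        have h2 := congrFun h1 i
        rw [Function.update_self] at h2
        rcases m with q | ⟨q, y⟩ | ⟨q, x⟩ | q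
        · exact stay h2
        · exact stay h2
        · unfold muted stamp
          rw [h2]
          exact ⟨rfl, Or.inr ⟨s, hs, src, q, x, hmem, rfl⟩⟩
        · exact stay h2
      · exact stay (by rw [h1, Function.update_of_ne hi])

lemma invoke_spec (he : e.IsExecution) {t c : ℕ} {op : RegOp V} (h : e.ev t = .invoke c op) :
    ¬ e.PendingAt c t ∧ client e (t + 1) c =
      ⟨(client e t c).count + 1, .query op (toLex (0, 0), v₀) ∅⟩ := by
  have hv := he.2.2 t
  unfold Run.ValidStep at hv
  rw [h] at hv
  obtain ⟨-, -, hp, st, out, hm, -, h2, -, -⟩ := hv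
  rw [Set.mem_singleton_iff] at hm
  refine ⟨hp, ?_⟩
  unfold client
  rw [h2, Function.update_self]
  exact congrArg Prod.fst hm

/-! ### Operations and their stamps -/

/-- The phase is a query phase. -/
def Phase.IsQuery (p : Phase n V) : Prop := ∃ op best heard, p = .query op best heard

/-- The operation `op` that client `c` invoked at time `a` commits at time `t` to the stamped value
`x`: it ends its query phase and starts to store `x`. The last field records where `x` comes
from. -/
structure Commits (e : Run (quorumRegister n V v₀ lock qr qw)) (c a t : ℕ) (op : RegOp V)
    (x : Tag × V) : Prop where
  inv : e.ev a = .invoke c op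
  lt : a < t
  query : ∀ s, a < s → s ≤ t → (client e s c).phase.IsQuery
  store : (client e (t + 1) c).phase = .store op x ∅
  best : ∃ best heard, (client e t c).phase = .query op best heard ∧ x = newStamp c op best ∧
    qr ≤ heard.card ∧ ∀ i ∈ heard, ∃ u, a < u ∧ muted e u i = false ∧ (stamp e u i).1 ≤ best.1

lemma count_le_succ (he : e.IsExecution) (c t : ℕ) :
    (client e t c).count ≤ (client e (t + 1) c).count := by
  cases client_move he c t <;> simp_all

lemma count_mono (he : e.IsExecution) (c : ℕ) : Monotone fun t => (client e t c).count :=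
  monotone_nat_of_le_succ (count_le_succ he c)

/-- A client in its query phase has a pending operation, and the replicas it has heard from have
answered since that operation was invoked. -/
lemma query_phase_spec (he : e.IsExecution) (c t : ℕ) : ∀ op best heard,
    (client e t c).phase = .query op best heard →
    ∃ a < t, e.ev a = .invoke c op ∧
      (∀ s ≤ a, (client e s c).count < (client e t c).count) ∧
      (∀ s, a < s → s ≤ t → (client e s c).phase.IsQuery) ∧
      (∀ s, a < s → s < t → ∀ ρ, e.resp s ≠ some (c, ρ)) ∧
      ∀ i ∈ heard, ∃ u, a < u ∧ muted e u i = false ∧ (stamp e u i).1 ≤ best.1 := by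
  induction t with
  | zero =>
    intro op best heard h
    have : client e 0 c = ⟨0, .idle⟩ := by unfold client; rw [he.2.1]
    rw [this] at h; cases h
  | succ t ih =>
    intro op best heard h
    have hist := h
    cases client_move he c t with
    | stay hst hr =>
      rw [hst] at h ⊢
      obtain ⟨a, ha, h1, h2, h3, h4, h5⟩ := ih op best heard h
      refine ⟨a, by omega, h1, h2, fun s hs hs' => ?_, fun s hs hs' => ?_, h5⟩
      · rcases Nat.lt_succ_iff_lt_or_eq.1 (Nat.lt_succ_of_le hs') with h' | rfl
        · exact h3 s hs (by omega)
        · exact ⟨_, _, _, hist⟩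
      · rcases Nat.lt_succ_iff_lt_or_eq.1 hs' with h' | rfl
        exacts [h4 s hs h', hr]
    | invoke op' hev hst hr =>
      rw [hst] at h ⊢
      cases h
      refine ⟨t, by omega, hev, fun s hs => ?_, fun s hs hs' => ?_, fun s hs hs' => by omega,
        by simp⟩
      · exact Nat.lt_succ_of_le (count_mono he c hs)
      · obtain rfl : s = t + 1 := by omega
        exact ⟨_, _, _, hist⟩
    | hear op' best' heard' i y s h0 hs hpk hst hr =>
      obtain ⟨a, ha, h1, h2, h3, h4, h5⟩ := ih _ _ _ h0
      rw [hst] at h ⊢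
      cases h
      refine ⟨a, by omega, h1, h2, fun s hs hs' => ?_, fun s hs hs' => ?_, fun j hj => ?_⟩
      · rcases Nat.lt_succ_iff_lt_or_eq.1 (Nat.lt_succ_of_le hs') with h' | rfl
        · exact h3 s hs (by omega)
        · exact ⟨_, _, _, hist⟩
      · rcases Nat.lt_succ_iff_lt_or_eq.1 hs' with h' | rfl
        · exact h4 s hs h'
        · simp [hr]
      · rcases Finset.mem_insert.1 hj with rfl | hj
        · obtain ⟨⟨s', hs', hq⟩, hm, rfl⟩ := sent_queryReply he hpk
          -- the query that is answered was sent during the present operation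
          have hc : (client e s' c).count = (client e t c).count := by
            rcases sent_by_client he hq with ⟨-, h'⟩ | ⟨_, _, _, -, h'⟩
            · simpa using h'.symm
            · cases h'
          have : a < s' := by
            by_contra hlt
            exact (h2 s' (not_lt.1 hlt)).ne hc
          exact ⟨s, by omega, hm, le_later_right _ _⟩
        · obtain ⟨u, hu, hm, hle⟩ := h5 j hj
          exact ⟨u, hu, hm, hle.trans (le_later_left _ _)⟩
    | commit _ _ _ _ _ hst => rw [hst] at h; cases h
    | ack _ _ _ _ _ _ _ _ hst => rw [hst] at h; cases h
    | finish _ _ _ _ _ hst => rw [hst] at h; cases h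

lemma commits_of_move (he : e.IsExecution) {c t : ℕ} {op : RegOp V} {best : Tag × V}
    {heard : Finset (Fin n)} (h0 : (client e t c).phase = .query op best heard)
    (hq : qr ≤ heard.card)
    (hst : client e (t + 1) c = ⟨(client e t c).count, .store op (newStamp c op best) ∅⟩) :
    ∃ a, Commits e c a t op (newStamp c op best) ∧
      (∀ s ≤ a, (client e s c).count < (client e t c).count) ∧
      ∀ s, a < s → s < t → ∀ ρ, e.resp s ≠ some (c, ρ) := by
  obtain ⟨a, ha, h1, h2, h3, h4, h5⟩ := query_phase_spec he c t _ _ _ h0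
  exact ⟨a, ⟨h1, ha, h3, by rw [hst], best, heard, h0, rfl, hq, h5⟩, h2, h4⟩

/-- A client in its store phase has a pending operation that has committed, and the replicas that
have acknowledged did store its stamped value. -/
lemma store_phase_spec (he : e.IsExecution) (c t : ℕ) : ∀ op x acked,
    (client e t c).phase = .store op x acked →
    ∃ a t₀, t₀ < t ∧ Commits e c a t₀ op x ∧
      (∀ s ≤ t₀, (client e s c).count = (client e t c).count → (client e s c).phase.IsQuery) ∧
      (∀ s, t₀ < s → s ≤ t → ∃ acked', (client e s c).phase = .store op x acked') ∧
      (∀ s, a < s → s < t → ∀ ρ, e.resp s ≠ some (c, ρ)) ∧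
      ∀ i ∈ acked, ∃ u < t, x.1 ≤ (stamp e (u + 1) i).1 := by
  induction t with
  | zero =>
    intro op x acked h
    have : client e 0 c = ⟨0, .idle⟩ := by unfold client; rw [he.2.1]
    rw [this] at h; cases h
  | succ t ih =>
    intro op x acked h
    have hist := h
    cases client_move he c t with
    | stay hst hr =>
      rw [hst] at h ⊢
      obtain ⟨a, t₀, ht, h1, h2, h3, h4, h5⟩ := ih _ _ _ h
      refine ⟨a, t₀, by omega, h1, h2, fun s hs hs' => ?_, fun s hs hs' => ?_, fun i hi => ?_⟩
      · rcases Nat.lt_succ_iff_lt_or_eq.1 (Nat.lt_succ_of_le hs') with h' | rfl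
        · exact h3 s hs (by omega)
        · exact ⟨_, hist⟩
      · rcases Nat.lt_succ_iff_lt_or_eq.1 hs' with h' | rfl
        exacts [h4 s hs h', hr]
      · obtain ⟨u, hu, hle⟩ := h5 i hi
        exact ⟨u, by omega, hle⟩
    | commit op' best heard h0 hq hst hr =>
      obtain ⟨a, h1, h2, h4⟩ := commits_of_move he h0 hq hst
      rw [hst] at h ⊢
      cases h
      refine ⟨a, t, by omega, h1, fun s hs hc => ?_, fun s hs hs' => ?_, fun s hs hs' => ?_,
        by simp⟩
      · refine h1.query s ?_ hs
        by_contra hlt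
        exact (h2 s (not_lt.1 hlt)).ne hc
      · obtain rfl : s = t + 1 := by omega
        exact ⟨_, hist⟩
      · rcases Nat.lt_succ_iff_lt_or_eq.1 hs' with h' | rfl
        · exact h4 s hs h'
        · simp [hr]
    | ack op' x' acked' i s h0 hs hpk hst hr =>
      obtain ⟨a, t₀, ht, h1, h2, h3, h4, h5⟩ := ih _ _ _ h0
      rw [hst] at h ⊢
      cases h
      refine ⟨a, t₀, by omega, h1, h2, fun s hs hs' => ?_, fun s hs hs' => ?_, fun j hj => ?_⟩
      · rcases Nat.lt_succ_iff_lt_or_eq.1 (Nat.lt_succ_of_le hs') with h' | rfl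
        · exact h3 s hs (by omega)
        · exact ⟨_, hist⟩
      · rcases Nat.lt_succ_iff_lt_or_eq.1 hs' with h' | rfl
        · exact h4 s hs h'
        · simp [hr]
      · rcases Finset.mem_insert.1 hj with rfl | hj
        · obtain ⟨y, ⟨s', hs', hq⟩, hle⟩ := sent_storeAck he hpk
          rcases sent_by_client he hq with ⟨-, h'⟩ | ⟨op', y', acked', hph, h'⟩
          · cases h'
          · simp only [QMsg.store.injEq] at h'
            obtain ⟨hc, rfl⟩ := h'
            -- the request that is acknowledged was sent during the present store phase
            have hlt : t₀ < s' := by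
              by_contra hlt
              obtain ⟨_, _, _, hph'⟩ := h2 s' (not_lt.1 hlt) hc.symm
              rw [hph] at hph'; cases hph'
            obtain ⟨acked'', hph'⟩ := h3 s' hlt (by omega)
            rw [hph] at hph'
            cases hph'
            exact ⟨s, by omega, hle⟩
        · obtain ⟨u, hu, hle⟩ := h5 j hj
          exact ⟨u, by omega, hle⟩
    | invoke _ _ hst => rw [hst] at h; cases h
    | hear _ _ _ _ _ _ _ _ _ hst => rw [hst] at h; cases h
    | finish _ _ _ _ _ hst => rw [hst] at h; cases h

lemma exists_resp_between (he : e.IsExecution) {c a a' : ℕ} {op op' : RegOp V} (h : a < a')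
    (ha : e.ev a = .invoke c op) (ha' : e.ev a' = .invoke c op') :
    ∃ s, a < s ∧ s < a' ∧ ∃ ρ, e.resp s = some (c, ρ) := by
  by_contra! hcon
  exact (invoke_spec he ha').1 ⟨a, h, ⟨op, ha⟩, hcon⟩

lemma invoke_eq (he : e.IsExecution) {c a a' t : ℕ} {op op' : RegOp V}
    (ha : e.ev a = .invoke c op) (ha' : e.ev a' = .invoke c op') (hat : a < t) (hat' : a' < t)
    (hr : ∀ s, a < s → s < t → ∀ ρ, e.resp s ≠ some (c, ρ))
    (hr' : ∀ s, a' < s → s < t → ∀ ρ, e.resp s ≠ some (c, ρ)) : a = a' := by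
  rcases lt_trichotomy a a' with h | h | h
  · obtain ⟨s, h1, h2, ρ, h3⟩ := exists_resp_between he h ha ha'
    exact (hr s h1 (h2.trans hat') ρ h3).elim
  · exact h
  · obtain ⟨s, h1, h2, ρ, h3⟩ := exists_resp_between he h ha' ha
    exact (hr' s h1 (h2.trans hat) ρ h3).elim

lemma resp_spec (he : e.IsExecution) {c t : ℕ} {ρ : RegResp V} (h : e.resp t = some (c, ρ)) :
    ∃ a t₀ op x, ∃ acked : Finset (Fin n), t₀ < t ∧ Commits e c a t₀ op x ∧ ρ = response op x ∧ qw ≤ acked.card ∧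
      (∀ s, a < s → s < t → ∀ ρ, e.resp s ≠ some (c, ρ)) ∧
      ∀ i ∈ acked, ∃ u < t, x.1 ≤ (stamp e (u + 1) i).1 := by
  cases client_move he c t with
  | stay _ hr => exact (hr ρ h).elim
  | invoke _ _ _ hr => simp [hr] at h
  | hear _ _ _ _ _ _ _ _ _ _ hr => simp [hr] at h
  | commit _ _ _ _ _ _ hr => simp [hr] at h
  | ack _ _ _ _ _ _ _ _ _ hr => simp [hr] at h
  | finish op x acked h0 hq _ hr =>
    rw [h] at hr
    obtain ⟨a, t₀, ht, h1, -, -, h4, h5⟩ := store_phase_spec he c t _ _ _ h0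
    simp only [Option.some.injEq, Prod.mk.injEq, true_and] at hr
    exact ⟨a, t₀, op, x, acked, ht, h1, hr, hq, h4, h5⟩

lemma pendingAt_of_resp (he : e.IsExecution) {c t : ℕ} {ρ : RegResp V}
    (h : e.resp t = some (c, ρ)) : e.PendingAt c t := by
  obtain ⟨a, t₀, op, x, acked, ht, h1, -, -, h4, -⟩ := resp_spec he h
  exact ⟨a, h1.lt.trans ht, ⟨op, h1.inv⟩, h4⟩

/-- An operation that returns has committed, and a store quorum has stored its stamped value. -/
lemma returns_spec (he : e.IsExecution) {a t : ℕ} {ρ : RegResp V} (h : e.Returns a t ρ) :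
    ∃ c t₀ op x, ∃ acked : Finset (Fin n), t₀ < t ∧ Commits e c a t₀ op x ∧ ρ = response op x ∧ qw ≤ acked.card ∧
      ∀ i ∈ acked, ∃ u < t, x.1 ≤ (stamp e (u + 1) i).1 := by
  obtain ⟨c, op, hinv, hat, hr, hno⟩ := h
  obtain ⟨a', t₀, op', x, acked, ht, h1, h2, h3, h4, h5⟩ := resp_spec he hr
  obtain rfl := invoke_eq he hinv h1.inv hat (h1.lt.trans ht) hno h4
  exact ⟨c, t₀, op', x, acked, ht, h1, h2, h3, h5⟩

lemma Commits.unique {c c' a t t' : ℕ} {op op' : RegOp V} {x x' : Tag × V}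
    (h : Commits e c a t op x) (h' : Commits e c' a t' op' x') :
    c = c' ∧ t = t' ∧ op = op' ∧ x = x' := by
  have h1 := h.inv
  rw [h'.inv] at h1
  cases h1
  have key : ∀ {t t' : ℕ} {x x' : Tag × V}, Commits e c a t op x → Commits e c a t' op x' →
      ¬ t < t' := fun h h' hlt => by
    obtain ⟨_, _, _, hq⟩ := h'.query _ (h.lt.trans (Nat.lt_succ_self _)) hlt
    rw [h.store] at hq; cases hq
  obtain rfl : t = t' := le_antisymm (not_lt.1 (key h' h)) (not_lt.1 (key h h'))
  have h2 := h.store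
  rw [h'.store] at h2
  cases h2
  exact ⟨rfl, rfl, rfl, rfl⟩

/-- The replica does not lose stamped values before time `u`. -/
def TagMonoUpTo (e : Run (quorumRegister n V v₀ lock qr qw)) (i : Fin n) (u : ℕ) : Prop :=
  ∀ s t, s ≤ t → t ≤ u → (stamp e s i).1 ≤ (stamp e t i).1

/-- A store quorum and a query quorum always have a replica in common that has lost nothing when it
answers the query. -/
def QuorumsMeet (e : Run (quorumRegister n V v₀ lock qr qw)) : Prop :=
  ∀ W R : Finset (Fin n), qw ≤ W.card → qr ≤ R.card →
    ∃ i ∈ W, i ∈ R ∧ ∀ u, muted e u i = false → TagMonoUpTo e i u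

/-- The query phase of an operation finds a tag at least as large as those of all operations that
returned before it was invoked. -/
lemma tag_le_of_returns (he : e.IsExecution) (hm : QuorumsMeet e) {a t ρ c c' a' t₀ t₀' : _}
    {op op' : RegOp V} {x x' : Tag × V} (hret : e.Returns a t ρ) (h : Commits e c a t₀ op x)
    (h' : Commits e c' a' t₀' op' x') (hlt : t < a') :
    ∃ best : Tag × V, x.1 ≤ best.1 ∧ x' = newStamp c' op' best := by
  obtain ⟨c1, t1, op1, x1, W, -, h1, -, hW, hs⟩ := returns_spec he hret
  obtain ⟨-, -, -, rfl⟩ := h.unique h1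
  obtain ⟨best, R, -, hx, hR, hb⟩ := h'.best
  obtain ⟨i, hiW, hiR, hmono⟩ := hm W R hW hR
  obtain ⟨u, hu, hle⟩ := hs i hiW
  obtain ⟨u', hu', hmu, hle'⟩ := hb i hiR
  exact ⟨best, (hle.trans (hmono u' hmu (u + 1) u' (by omega) le_rfl)).trans hle', hx⟩

lemma tag_le (he : e.IsExecution) (hm : QuorumsMeet e) {a t ρ c c' a' t₀ t₀' : _}
    {op op' : RegOp V} {x x' : Tag × V} (hret : e.Returns a t ρ) (h : Commits e c a t₀ op x)
    (h' : Commits e c' a' t₀' op' x') (hlt : t < a') : x.1 ≤ x'.1 := by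
  obtain ⟨best, hle, rfl⟩ := tag_le_of_returns he hm hret h h' hlt
  exact hle.trans (le_newStamp _ _ _)

lemma tag_lt_write (he : e.IsExecution) (hm : QuorumsMeet e) {a t ρ c c' a' t₀ t₀' : _}
    {op : RegOp V} {w : V} {x x' : Tag × V} (hret : e.Returns a t ρ) (h : Commits e c a t₀ op x)
    (h' : Commits e c' a' t₀' (.write w) x') (hlt : t < a') : x.1 < x'.1 := by
  obtain ⟨best, hle, rfl⟩ := tag_le_of_returns he hm hret h h' hlt
  exact hle.trans_lt (lt_newStamp_write _ _ _)

/-- The stamp of a write: its value, the name of its client, and a tag larger than the initial one. -/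
lemma Commits.write_tag {c a t : ℕ} {w : V} {x : Tag × V} (h : Commits e c a t (.write w) x) :
    x.2 = w ∧ (ofLex x.1).2 = c ∧ toLex (0, 0) < x.1 := by
  obtain ⟨best, -, -, rfl, -⟩ := h.best
  exact ⟨rfl, rfl, Prod.Lex.lt_iff.2 (Or.inl (Nat.succ_pos _))⟩

lemma write_tag_injective (he : e.IsExecution) (hm : QuorumsMeet e) {c c' a a' t t' : ℕ}
    {w w' : V} {x x' : Tag × V} (h : Commits e c a t (.write w) x)
    (h' : Commits e c' a' t' (.write w') x') (hx : x.1 = x'.1) : a = a' := by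
  have key : ∀ {c c' a a' t t' : ℕ} {w w' : V} {x x' : Tag × V}, Commits e c a t (.write w) x →
      Commits e c' a' t' (.write w') x' → x.1 = x'.1 → ¬ a < a' := by
    intro c c' a a' t t' w w' x x' h h' hx hlt
    obtain rfl : c = c' := by rw [← h.write_tag.2.1, ← h'.write_tag.2.1, hx]
    classical
    -- the first response after `a` is that of the first of the two writes
    have hex := exists_resp_between he hlt h.inv h'.inv
    obtain ⟨h1, h2, ρ, h3⟩ := Nat.find_spec hex
    have hret : e.Returns a (Nat.find hex) ρ := by
      refine ⟨c, _, h.inv, h1, h3, fun s hs hs' ρ' hρ => Nat.find_min hex hs' ?_⟩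
      exact ⟨hs, hs'.trans h2, ρ', hρ⟩
    exact (tag_lt_write he hm hret h h' h2).ne hx
  exact le_antisymm (not_lt.1 (key h' h hx.symm)) (not_lt.1 (key h h' hx))

/-- The stamped value is the initial one, or a write has committed to it before time `t`. -/
def Known (e : Run (quorumRegister n V v₀ lock qr qw)) (t : ℕ) (x : Tag × V) : Prop :=
  x = (toLex (0, 0), v₀) ∨ ∃ c a t₀ w, t₀ < t ∧ Commits e c a t₀ (.write w) x

lemma Known.mono {s t : ℕ} {x : Tag × V} (h : Known e s x) (hst : s ≤ t) : Known e t x := by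
  rcases h with h | ⟨c, a, t₀, w, h1, h2⟩
  exacts [Or.inl h, Or.inr ⟨c, a, t₀, w, by omega, h2⟩]

lemma Known.later {t : ℕ} {x y : Tag × V} (hx : Known e t x) (hy : Known e t y) :
    Known e t (later x y) := by
  rcases later_eq_or x y with h | h <;> rwa [h]

/-- All stamped values that replicas and clients hold are known. -/
lemma known_of_held (he : e.IsExecution) (t : ℕ) :
    (∀ i, Known e t (stamp e t i)) ∧
    (∀ c op best heard, (client e t c).phase = .query op best heard → Known e t best) ∧
    ∀ c op x acked, (client e t c).phase = .store op x acked → Known e t x := by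
  induction t using Nat.strong_induction_on with
  | _ t ih =>
  rcases t with _ | t
  · have h0 : ∀ c, client e 0 c = ⟨0, .idle⟩ := fun c => by unfold client; rw [he.2.1]
    refine ⟨fun i => Or.inl ?_, fun c op best heard h => ?_, fun c op x acked h => ?_⟩
    · unfold stamp; rw [he.1]
    · rw [h0] at h; cases h
    · rw [h0] at h; cases h
  · obtain ⟨iR, iQ, iS⟩ := ih t (Nat.lt_succ_self t)
    refine ⟨fun i => ?_, fun c op best heard h => ?_, fun c op x acked h => ?_⟩
    · rcases replica_move he i t with ⟨-, h | ⟨s, hs, src, q, x, hpk, h⟩⟩ | ⟨-, -, h⟩ |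
        ⟨s, hs, -, -, h⟩
      · rw [h]; exact (iR i).mono (Nat.le_succ t)
      · rw [h]
        refine ((iR i).mono (Nat.le_succ t)).later ?_
        cases src with
        | client c =>
          rcases sent_by_client he hpk with ⟨-, h'⟩ | ⟨op, y, acked, hph, h'⟩
          · cases h'
          · simp only [QMsg.store.injEq] at h'
            obtain ⟨-, rfl⟩ := h'
            exact ((ih s (by omega)).2.2 c op x acked hph).mono (by omega)
        | replica i' =>
          rcases acts_of_mem_sent he hpk with ⟨-, ha⟩ | ⟨s', -, src, m', -, ha⟩
          · obtain ⟨-, -, h3, -⟩ := acts_replica ha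
            rw [h3] at hpk
            simp [replicaReact] at hpk
          · obtain ⟨-, -, h3, -⟩ := acts_replica ha
            rw [h3] at hpk
            rcases m' with q' | ⟨q', y'⟩ | ⟨q', x⟩ | q' <;> simp [replicaReact] at hpk
      · rw [h]; exact (iR i).mono (Nat.le_succ t)
      · rw [h]; exact ((ih s (by omega)).1 i).mono (by omega)
    · cases client_move he c t with
      | stay hst => rw [hst] at h; exact (iQ c _ _ _ h).mono (Nat.le_succ t)
      | invoke _ _ hst => rw [hst] at h; cases h; exact Or.inl rfl
      | hear op' best' heard' i y s h0 hs hpk hst hr =>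
        rw [hst] at h
        cases h
        obtain ⟨-, -, rfl⟩ := sent_queryReply he hpk
        exact ((iQ c _ _ _ h0).mono (Nat.le_succ t)).later
          (((ih s (by omega)).1 i).mono (by omega))
      | commit _ _ _ _ _ hst => rw [hst] at h; cases h
      | ack _ _ _ _ _ _ _ _ hst => rw [hst] at h; cases h
      | finish _ _ _ _ _ hst => rw [hst] at h; cases h
    · cases client_move he c t with
      | stay hst => rw [hst] at h; exact (iS c _ _ _ h).mono (Nat.le_succ t)
      | commit op' best heard h0 hq hst hr =>
        obtain ⟨a, h1, -⟩ := commits_of_move he h0 hq hst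
        rw [hst] at h
        cases h
        cases op with
        | read => exact (iQ c _ _ _ h0).mono (Nat.le_succ t)
        | write w => exact Or.inr ⟨c, a, t, w, Nat.lt_succ_self t, h1⟩
      | ack op' x' acked' i s h0 hs hpk hst hr =>
        rw [hst] at h
        cases h
        exact (iS c _ _ _ h0).mono (Nat.le_succ t)
      | invoke _ _ hst => rw [hst] at h; cases h
      | hear _ _ _ _ _ _ _ _ _ hst => rw [hst] at h; cases h
      | finish _ _ _ _ _ hst => rw [hst] at h; cases h

lemma Commits.known_read (he : e.IsExecution) {c a t : ℕ} {x : Tag × V}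
    (h : Commits e c a t .read x) : Known e t x := by
  obtain ⟨best, heard, h0, rfl, -⟩ := h.best
  exact (known_of_held he t).2.1 _ _ _ _ h0

/-! ### Linearizability -/

lemma exists_sorted_list {α κ : Type*} [LinearOrder κ] (S : Finset α) (key : α → κ)
    (hkey : Function.Injective key) :
    ∃ L : List α, L.Nodup ∧ (∀ a, a ∈ L ↔ a ∈ S) ∧ L.Pairwise fun a b => key a < key b := by
  let _ := LinearOrder.lift' key hkey
  exact ⟨S.sort (· ≤ ·), S.sort_nodup _, fun a => S.mem_sort _, (S.sortedLT_sort).pairwise⟩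

/-- A list of committed operations is legal if tags of writes are distinct, the list is sorted by tag
with reads after the write with the same tag, and each read either returns the present content `v`
of the register and has a smaller tag than all writes, or has the stamped value of a write in the
list. -/
lemma legal_of_sorted (he : e.IsExecution) (T : ℕ) (X : ℕ → Tag × V) (O : ℕ → RegOp V) :
    ∀ (L : List ℕ) (v : V),
    (∀ a ∈ L, ∀ b ∈ L, ∀ w w', O a = .write w → O b = .write w' → (X a).1 = (X b).1 → a = b) → (∀ a ∈ L, ∃ c t, Commits e c a t (O a) (X a)) →
    L.Pairwise (fun a b => (X a).1 < (X b).1 ∨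
      (X a).1 = (X b).1 ∧ ((∃ w, O a = .write w) ∨ O b = .read)) →
    L.Nodup →
    (∀ a ∈ L, O a = .read → ((X a).2 = v ∧ ∀ b ∈ L, ∀ w, O b = .write w → (X a).1 < (X b).1) ∨
      ∃ b ∈ L, ∃ w, O b = .write w ∧ X b = X a) →
    e.Legal T v L := by
  intro L
  induction L with
  | nil => intros; trivial
  | cons a l ih =>
    intro v hinj hC hP hN hR
    have hinj' := fun b hb b' hb' => hinj b (List.mem_cons_of_mem a hb) b' (List.mem_cons_of_mem a hb')
    obtain ⟨c, t, hc⟩ := hC a List.mem_cons_self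
    rw [List.pairwise_cons] at hP
    rw [List.nodup_cons] at hN
    have hret : ∀ t' ρ, e.Returns a t' ρ → ρ = response (O a) (X a) := fun t' ρ h => by
      obtain ⟨c', t₀, op, x, -, -, h1, h2, -⟩ := returns_spec he h
      obtain ⟨-, -, rfl, rfl⟩ := hc.unique h1
      exact h2
    cases hO : O a with
    | read =>
      rw [hO] at hret
      have hev := hc.inv
      rw [hO] at hev
      unfold Run.Legal
      rw [hev]
      have ha := hR a List.mem_cons_self hO
      have hv : (X a).2 = v := by
        rcases ha with h | ⟨b, hb, w, hw, hX⟩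
        · exact h.1
        · rcases List.mem_cons.1 hb with rfl | hb
          · rw [hO] at hw; cases hw
          · rcases hP.1 b hb with h | ⟨-, ⟨w', h⟩ | h⟩
            · rw [hX] at h; exact (lt_irrefl _ h).elim
            · rw [hO] at h; cases h
            · rw [hw] at h; cases h
      refine ⟨fun t' _ ρ h => by rw [hret t' ρ h, ← hv]; rfl,
        ih v hinj' (fun b hb => hC b (List.mem_cons_of_mem _ hb)) hP.2 hN.2 fun b hb hOb => ?_⟩
      rcases hR b (List.mem_cons_of_mem _ hb) hOb with ⟨h1, h2⟩ | ⟨b', hb', w, hw, hX⟩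
      · exact Or.inl ⟨h1, fun b' hb' => h2 b' (List.mem_cons_of_mem _ hb')⟩
      · rcases List.mem_cons.1 hb' with rfl | hb'
        · rw [hO] at hw; cases hw
        · exact Or.inr ⟨b', hb', w, hw, hX⟩
    | write w =>
      rw [hO] at hret
      have hev := hc.inv
      rw [hO] at hev hc
      unfold Run.Legal
      rw [hev]
      refine ⟨fun t' _ ρ h => hret t' ρ h,
        ih w hinj' (fun b hb => hC b (List.mem_cons_of_mem _ hb)) hP.2 hN.2 fun b hb hOb => ?_⟩
      rcases hR b (List.mem_cons_of_mem _ hb) hOb with ⟨-, h2⟩ | ⟨b', hb', w', hw, hX⟩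
      · have h3 := h2 a List.mem_cons_self w hO
        rcases hP.1 b hb with h | ⟨h, -⟩
        · exact (lt_asymm h h3).elim
        · exact (h3.ne h.symm).elim
      · rcases List.mem_cons.1 hb' with rfl | hb'
        · refine Or.inl ⟨by rw [← hX]; exact hc.write_tag.1, fun b'' hb'' w'' hw'' => ?_⟩
          rw [← hX]
          rcases hP.1 b'' hb'' with h | ⟨h, -⟩
          · exact h
          · exact (hN.1 (hinj _ List.mem_cons_self _ (List.mem_cons_of_mem _ hb'') _ _ hO hw'' h ▸ hb'')).elim
        · exact Or.inr ⟨b', hb', w', hw, hX⟩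

theorem linearizableUpTo (he : e.IsExecution) (hm : QuorumsMeet e) (T : ℕ) :
    e.LinearizableUpTo v₀ T := by
  classical
  let P : ℕ → Prop := fun a => ∃ c t op x, t < T ∧ Commits e c a t op x
  have hP : ∀ a, ∃ (O : RegOp V) (X : Tag × V), P a → ∃ c t, t < T ∧ Commits e c a t O X := by
    intro a
    by_cases h : P a
    · obtain ⟨c, t, op, x, h1, h2⟩ := h
      exact ⟨op, x, fun _ => ⟨c, t, h1, h2⟩⟩
    · exact ⟨.read, (toLex (0, 0), v₀), fun h' => (h h').elim⟩
  choose O X hOX using hP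
  let isRead : ℕ → ℕ := fun a => match O a with | .read => 1 | .write _ => 0
  let key : ℕ → Tag ×ₗ (ℕ ×ₗ ℕ) := fun a => toLex ((X a).1, toLex (isRead a, a))
  have hkey : Function.Injective key := fun a b h => by
    simp only [key, toLex_inj, Prod.mk.injEq] at h
    exact h.2.2
  obtain ⟨L, hN, hL, hsort⟩ := exists_sorted_list ((Finset.range T).filter P) key hkey
  have hL' : ∀ a, a ∈ L ↔ P a := fun a => by
    rw [hL, Finset.mem_filter, Finset.mem_range, and_iff_right_iff_imp]
    rintro ⟨c, t, op, x, h1, h2⟩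
    exact h2.lt.trans h1
  have hlt : ∀ a b, key a < key b → (X a).1 < (X b).1 ∨
      (X a).1 = (X b).1 ∧ (isRead a < isRead b ∨ isRead a = isRead b ∧ a < b) := by
    intro a b h
    simpa only [key, Prod.Lex.toLex_lt_toLex] using h
  refine ⟨L, hN, fun a ha => ?_, fun a t ht ρ hret => ?_, ?_, ?_⟩
  · exact Finset.mem_range.1 (Finset.mem_filter.1 ((hL a).1 ha)).1
  · obtain ⟨c, t₀, op, x, -, h0, h1, -⟩ := returns_spec he hret
    exact (hL' a).2 ⟨c, t₀, op, x, h0.trans ht, h1⟩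
  · refine hsort.imp_of_mem fun {a b} ha hb h => ?_
    rintro ⟨t, ρ, hret, hta⟩
    obtain ⟨c, t₀, -, hCa⟩ := hOX a ((hL' a).1 ha)
    obtain ⟨c', t₀', -, hCb⟩ := hOX b ((hL' b).1 hb)
    have hba : b < a := by
      obtain ⟨_, _, _, h1, _⟩ := hret
      omega
    have hle := tag_le he hm hret hCb hCa hta
    rcases hlt a b h with h1 | ⟨h1, h2⟩
    · exact (not_lt.2 hle h1).elim
    · cases hOa : O a with
      | write w =>
        rw [hOa] at hCa
        exact (tag_lt_write he hm hret hCb hCa hta).ne h1.symm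
      | read =>
        have : isRead a = 1 := by simp [isRead, hOa]
        have : isRead b ≤ 1 := by simp only [isRead]; split <;> omega
        omega
  · have hC : ∀ a ∈ L, ∃ c t, Commits e c a t (O a) (X a) := fun a ha => by
      obtain ⟨c, t, -, h⟩ := hOX a ((hL' a).1 ha)
      exact ⟨c, t, h⟩
    refine legal_of_sorted he T X O L v₀ (fun a ha b hb w w' hOa hOb h => ?_) hC
      (hsort.imp fun {a b} h => ?_) hN fun a ha hOa => ?_
    · obtain ⟨c, t, h1⟩ := hC a ha
      obtain ⟨c', t', h2⟩ := hC b hb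
      rw [hOa] at h1
      rw [hOb] at h2
      exact write_tag_injective he hm h1 h2 h
    · refine (hlt a b h).imp_right fun ⟨h1, h2⟩ => ⟨h1, ?_⟩
      cases hOa : O a with
      | write w => exact Or.inl ⟨w, rfl⟩
      | read =>
        cases hOb : O b with
        | read => exact Or.inr rfl
        | write w => simp [isRead, hOa, hOb] at h2
    · obtain ⟨c, t, htT, h1⟩ := hOX a ((hL' a).1 ha)
      rw [hOa] at h1
      rcases h1.known_read he with h | ⟨c', b, t', w, ht', h2⟩
      · refine Or.inl ⟨by rw [h], fun b hb w hw => ?_⟩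
        obtain ⟨c', t', h2⟩ := hC b hb
        rw [hw] at h2
        rw [h]
        exact h2.write_tag.2.2
      · have hPb : P b := ⟨c', t', _, _, ht'.trans htT, h2⟩
        obtain ⟨_, _, -, h3⟩ := hOX b hPb
        obtain ⟨-, -, h4, h5⟩ := h2.unique h3
        exact Or.inr ⟨b, (hL' b).2 hPb, w, h4.symm, h5.symm⟩

/-! ### Intersection of quorums -/

lemma tagMonoUpTo_of_succ {i : Fin n} {u : ℕ}
    (h : ∀ t < u, (stamp e t i).1 ≤ (stamp e (t + 1) i).1) : TagMonoUpTo e i u := by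
  intro s t hst
  induction t, hst using Nat.le_induction with
  | base => exact fun _ => le_rfl
  | succ t _ ih => exact fun ht => (ih (by omega)).trans (h t (by omega))

lemma tagMonoUpTo_of_not_rollsBack (he : e.IsExecution) {i : Fin n} (h : ¬ e.RollsBack i) (u : ℕ) :
    TagMonoUpTo e i u := by
  refine tagMonoUpTo_of_succ fun t _ => ?_
  rcases replica_move he i t with ⟨-, h' | ⟨_, -, _, _, x, -, h'⟩⟩ | ⟨-, -, h'⟩ | ⟨s, -, h', -⟩
  · rw [h']
  · rw [h']; exact le_later_left _ _
  · rw [h']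
  · exact (h ⟨t, s, h'⟩).elim

lemma tagMonoUpTo_of_not_muted {e : Run (quorumRegister n V v₀ true qr qw)} (he : e.IsExecution)
    {i : Fin n} {u : ℕ} (h : muted e u i = false) : TagMonoUpTo e i u := by
  have hmu : ∀ t, muted e (t + 1) i = false → muted e t i = false ∧
      (stamp e t i).1 ≤ (stamp e (t + 1) i).1 := by
    intro t ht
    rcases replica_move he i t with ⟨h1, h' | ⟨_, -, _, _, x, -, h'⟩⟩ | ⟨-, h', -⟩ |
      ⟨s, -, -, h', -⟩
    · exact ⟨h1 ▸ ht, by rw [h']⟩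
    · exact ⟨h1 ▸ ht, by rw [h']; exact le_later_left _ _⟩
    · rw [ht] at h'; cases h'
    · rw [ht] at h'; cases h'
  have key : ∀ t ≤ u, muted e t i = false := fun t ht =>
    Nat.decreasingInduction (motive := fun t _ => muted e t i = false)
      (fun t _ h => (hmu t h).1) h ht
  exact tagMonoUpTo_of_succ fun t ht => (hmu t (key _ ht)).2

lemma lt_card_inter {W R : Finset (Fin n)} {m : ℕ} (h : n + m < W.card + R.card) :
    m < (W ∩ R).card := by
  have h1 := Finset.card_union_add_card_inter W R
  have h2 := card_finset_fin_le (W ∪ R)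
  omega

/-- Query quorums consist of replicas that have never restarted, hence lost nothing, so it suffices
that they intersect store quorums. -/
lemma quorumsMeet_of_lock {e : Run (quorumRegister n V v₀ true qr qw)} (he : e.IsExecution)
    (hn : n < qw + qr) : QuorumsMeet e := by
  intro W R hW hR
  obtain ⟨i, hi⟩ := Finset.card_pos.1 (lt_card_inter (W := W) (R := R) (m := 0) (by omega))
  rw [Finset.mem_inter] at hi
  exact ⟨i, hi.1, hi.2, fun u hu => tagMonoUpTo_of_not_muted he hu⟩

/-- Quorums intersect in more replicas than can roll back. -/
lemma quorumsMeet_of_rollbackFaulty (he : e.IsExecution) {r : ℕ}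
    (hr : {i | e.RollbackFaulty i}.ncard ≤ r) (hn : n + r < qw + qr) : QuorumsMeet e := by
  intro W R hW hR
  have h1 := lt_card_inter (W := W) (R := R) (m := r) (by omega)
  obtain ⟨i, hi, hni⟩ : ∃ i ∈ W ∩ R, ¬ e.RollbackFaulty i := by
    by_contra! hcon
    have h2 := Set.ncard_le_ncard (s := (↑(W ∩ R) : Set (Fin n))) (t := {i | e.RollbackFaulty i})
      (fun i hi => hcon i hi)
    rw [Set.ncard_coe_finset] at h2
    omega
  rw [Finset.mem_inter] at hi
  have : ¬ e.RollsBack i := fun h => hni ⟨fun hc => hc.2 h, h⟩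
  exact ⟨i, hi.1, hi.2, fun u _ => tagMonoUpTo_of_not_rollsBack he this u⟩

/-! ### Wait-freedom -/

/-- In a fair execution, a message between processes that stay up causes an action. -/
lemma acts_of_fair (he : e.IsExecution) (hf : e.Fair) {p q : Proc n} (hp : e.Present p)
    (hq : e.Present q) {T s : ℕ} (hT : ∀ t, T ≤ t → e.UpAt p t ∧ e.UpAt q t) (hs : T ≤ s)
    {m : QMsg V} (h : ⟨p, q, m⟩ ∈ e.sent s) : ∃ t, s < t ∧ e.Acts t q (.recv p m) := by
  obtain ⟨j, hj⟩ := List.mem_iff_getElem?.1 h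
  obtain ⟨t, ht⟩ := hf.2 p q hp hq T hT s hs j m hj
  have hv := he.2.2 t
  unfold Run.ValidStep at hv
  rw [ht] at hv
  obtain ⟨pk, hst, hpk, -, -, -, ha⟩ := hv
  rw [hj] at hpk
  cases hpk
  exact ⟨t, hst, ha⟩

lemma acts_of_tick (he : e.IsExecution) {p : Proc n} {t : ℕ} (h : e.ev t = .tick p) :
    e.Acts t p .tick := by
  have hv := he.2.2 t
  unfold Run.ValidStep at hv
  rw [h] at hv
  exact hv.2.2

lemma mem_broadcast (c : ℕ) (m : QMsg V) (i : Fin n) :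
    (⟨.client c, .replica i, m⟩ : Packet n (QMsg V)) ∈
      (broadcast m).map (fun d => (⟨.client c, d.1, d.2⟩ : Packet n (QMsg V))) := by
  simp [broadcast]

/-- The replicas that a client has heard from in its present phase. -/
def Phase.replied : Phase n V → Finset (Fin n)
  | .idle => ∅
  | .query _ _ heard => heard
  | .store _ _ acked => acked

lemma upAt_client {c : ℕ} (hc : e.CorrectClient c) (t : ℕ) : e.UpAt (.client c) t := by
  rintro ⟨t', -, h, -⟩
  exact hc.2 t' h

/-- If every replica of a set replies eventually, and replies are not forgotten, then there is a
local step of the client before which the whole set has replied. -/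
lemma exists_tick_replied (hf : e.Fair) {c a : ℕ} (hc : e.CorrectClient c) (R : Finset (Fin n))
    (hmono : ∀ t, a < t → (client e t c).phase.replied ⊆ (client e (t + 1) c).phase.replied)
    (h : ∀ i ∈ R, ∃ t, a < t ∧ i ∈ (client e t c).phase.replied) :
    ∃ t, a < t ∧ e.ev t = .tick (.client c) ∧ R ⊆ (client e t c).phase.replied := by
  have h1 : ∀ᶠ t in Filter.atTop, ∀ i ∈ R, i ∈ (client e t c).phase.replied := by
    rw [Filter.eventually_all_finset]
    intro i hi
    obtain ⟨t, hat, ht⟩ := h i hi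
    filter_upwards [Filter.eventually_ge_atTop t] with s hs
    induction s, hs using Nat.le_induction with
    | base => exact ht
    | succ s hs ih => exact hmono s (by omega) ih
  obtain ⟨N, hN⟩ := Filter.eventually_atTop.1 h1
  obtain ⟨t, ht, hev⟩ := hf.1 (.client c) hc.1 ⟨0, fun t _ => upAt_client hc t⟩ (max N (a + 1))
  exact ⟨t, by omega, hev, fun i hi => hN t (by omega) i hi⟩

lemma exists_tick_ge (hf : e.Fair) {c : ℕ} (hc : e.CorrectClient c) (T : ℕ) :
    ∃ t, T ≤ t ∧ e.ev t = .tick (.client c) :=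
  hf.1 (.client c) hc.1 ⟨0, fun t _ => upAt_client hc t⟩ T

/-- A correct client does not query for ever. -/
lemma query_phase_ends (he : e.IsExecution) (hf : e.Fair) {c a q : ℕ} (hc : e.CorrectClient c)
    (R : Finset (Fin n)) (hR : qr ≤ R.card)
    (hRup : ∀ i ∈ R, e.EventuallyUp (.replica i) ∧ ∀ t, muted e t i = false)
    (hq : ∀ t, a < t → (client e t c).count = q) :
    ∃ t, a < t ∧ ¬ (client e t c).phase.IsQuery := by
  by_contra! hcon
  have hmono : ∀ t, a < t →
      (client e t c).phase.replied ⊆ (client e (t + 1) c).phase.replied := by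
    intro t ht
    have hn := hcon (t + 1) (by omega)
    cases client_move he c t with
    | stay hst => rw [hst]
    | invoke op hev hst =>
      have h1 := hq t ht
      have h2 := hq (t + 1) (by omega)
      rw [hst] at h2
      simp only at h2
      omega
    | hear op best heard i y s h0 hs hpk hst =>
      rw [h0, hst]; exact Finset.subset_insert _ _
    | commit _ _ _ _ _ hst => rw [hst] at hn; obtain ⟨_, _, _, h⟩ := hn; cases h
    | ack _ _ _ _ _ _ _ _ hst => rw [hst] at hn; obtain ⟨_, _, _, h⟩ := hn; cases h
    | finish _ _ _ _ _ hst => rw [hst] at hn; obtain ⟨_, _, _, h⟩ := hn; cases h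
  have hrep : ∀ i ∈ R, ∃ t, a < t ∧ i ∈ (client e t c).phase.replied := by
    intro i hi
    obtain ⟨⟨T, hT⟩, hmu⟩ := hRup i hi
    obtain ⟨t, ht, hev⟩ := exists_tick_ge hf hc (max T (a + 1))
    obtain ⟨op, best, heard, hph⟩ := hcon t (by omega)
    obtain ⟨h1, -, h3, -⟩ := acts_client (acts_of_tick he hev)
    by_cases hcard : qr ≤ heard.card
    · simp only [clientReact, hph, if_pos hcard] at h1
      obtain ⟨_, _, _, h⟩ := hcon (t + 1) (by omega)
      rw [h1] at h
      cases h
    simp only [clientReact, hph, if_neg hcard] at h3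
    rw [hq t (by omega)] at h3
    have hpk := mem_broadcast (V := V) c (.query q) i
    rw [← h3] at hpk
    obtain ⟨t', htt', ha'⟩ := acts_of_fair he hf (p := .client c) (q := .replica i) hc.1 trivial
      (T := T) (fun t ht => ⟨upAt_client hc t, hT t ht⟩) (by omega) hpk
    obtain ⟨-, -, h3', -⟩ := acts_replica ha'
    have hm' : (e.rep t' i).1 = false := hmu t'
    simp only [replicaReact, hm', Bool.false_eq_true, if_false] at h3'
    obtain ⟨t'', htt'', ha''⟩ := acts_of_fair he hf (p := .replica i) (q := .client c)
      (s := t') (m := .queryReply q (e.rep t' i).2) trivial hc.1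
      (T := T) (fun t ht => ⟨hT t ht, upAt_client hc t⟩) (by omega) (by rw [h3']; simp)
    obtain ⟨h1'', -⟩ := acts_client ha''
    obtain ⟨op', best', heard', hph'⟩ := hcon t'' (by omega)
    simp only [clientReact, hph', if_pos (hq t'' (by omega)).symm] at h1''
    refine ⟨t'' + 1, by omega, ?_⟩
    rw [h1'']
    exact Finset.mem_insert_self _ _
  obtain ⟨t, hat, hev, hsub⟩ := exists_tick_replied hf hc R (a := a) hmono hrep
  obtain ⟨op, best, heard, hph⟩ := hcon t hat
  obtain ⟨h1, -⟩ := acts_client (acts_of_tick he hev)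
  rw [hph] at hsub
  have hcard : qr ≤ heard.card := hR.trans (Finset.card_le_card hsub)
  simp only [clientReact, hph, if_pos hcard] at h1
  obtain ⟨_, _, _, h⟩ := hcon (t + 1) (by omega)
  rw [h1] at h
  cases h

/-- A correct client does not store for ever. -/
lemma store_phase_ends (he : e.IsExecution) (hf : e.Fair) {c a q : ℕ} (hc : e.CorrectClient c)
    (W : Finset (Fin n)) (hW : qw ≤ W.card) (hWup : ∀ i ∈ W, e.EventuallyUp (.replica i))
    (hq : ∀ t, a < t → (client e t c).count = q) :
    ∃ t, a < t ∧ ∀ op x acked, (client e t c).phase ≠ .store op x acked := by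
  by_contra! hcon
  have hmono : ∀ t, a < t →
      (client e t c).phase.replied ⊆ (client e (t + 1) c).phase.replied := by
    intro t ht
    have hn := hcon (t + 1) (by omega)
    cases client_move he c t with
    | stay hst => rw [hst]
    | ack op x acked i s h0 hs hpk hst =>
      rw [h0, hst]; exact Finset.subset_insert _ _
    | invoke _ _ hst => rw [hst] at hn; obtain ⟨_, _, _, h⟩ := hn; cases h
    | hear _ _ _ _ _ _ _ _ _ hst => rw [hst] at hn; obtain ⟨_, _, _, h⟩ := hn; cases h
    | commit _ _ _ h0 =>
      obtain ⟨_, _, _, h⟩ := hcon t ht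
      rw [h] at h0; cases h0
    | finish _ _ _ _ _ hst => rw [hst] at hn; obtain ⟨_, _, _, h⟩ := hn; cases h
  have hrep : ∀ i ∈ W, ∃ t, a < t ∧ i ∈ (client e t c).phase.replied := by
    intro i hi
    obtain ⟨T, hT⟩ := hWup i hi
    obtain ⟨t, ht, hev⟩ := exists_tick_ge hf hc (max T (a + 1))
    obtain ⟨op, x, acked, hph⟩ := hcon t (by omega)
    obtain ⟨h1, -, h3, -⟩ := acts_client (acts_of_tick he hev)
    by_cases hcard : qw ≤ acked.card
    · simp only [clientReact, hph, if_pos hcard] at h1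
      obtain ⟨_, _, _, h⟩ := hcon (t + 1) (by omega)
      rw [h1] at h
      cases h
    simp only [clientReact, hph, if_neg hcard] at h3
    rw [hq t (by omega)] at h3
    have hpk := mem_broadcast c (.store q x) i
    rw [← h3] at hpk
    obtain ⟨t', htt', ha'⟩ := acts_of_fair he hf (p := .client c) (q := .replica i) hc.1 trivial
      (T := T) (fun t ht => ⟨upAt_client hc t, hT t ht⟩) (by omega) hpk
    obtain ⟨-, -, h3', -⟩ := acts_replica ha'
    simp only [replicaReact] at h3'
    obtain ⟨t'', htt'', ha''⟩ := acts_of_fair he hf (p := .replica i) (q := .client c)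
      (s := t') (m := .storeAck q) trivial hc.1
      (T := T) (fun t ht => ⟨hT t ht, upAt_client hc t⟩) (by omega) (by rw [h3']; simp)
    obtain ⟨h1'', -⟩ := acts_client ha''
    obtain ⟨op', x', acked', hph'⟩ := hcon t'' (by omega)
    simp only [clientReact, hph', if_pos (hq t'' (by omega)).symm] at h1''
    refine ⟨t'' + 1, by omega, ?_⟩
    rw [h1'']
    exact Finset.mem_insert_self _ _
  obtain ⟨t, hat, hev, hsub⟩ := exists_tick_replied hf hc W (a := a) hmono hrep
  obtain ⟨op, x, acked, hph⟩ := hcon t hat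
  obtain ⟨h1, -⟩ := acts_client (acts_of_tick he hev)
  rw [hph] at hsub
  have hcard : qw ≤ acked.card := hW.trans (Finset.card_le_card hsub)
  simp only [clientReact, hph, if_pos hcard] at h1
  obtain ⟨_, _, _, h⟩ := hcon (t + 1) (by omega)
  rw [h1] at h
  cases h

theorem waitFree (he : e.IsExecution) (hf : e.Fair)
    (hR : ∃ R : Finset (Fin n), qr ≤ R.card ∧
      ∀ i ∈ R, e.EventuallyUp (.replica i) ∧ ∀ t, muted e t i = false)
    (hW : ∃ W : Finset (Fin n), qw ≤ W.card ∧ ∀ i ∈ W, e.EventuallyUp (.replica i)) :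
    e.WaitFree := by
  obtain ⟨R, hR, hRup⟩ := hR
  obtain ⟨W, hW, hWup⟩ := hW
  intro c hc a op hev
  by_contra! hcon
  have hno : ∀ s, a < s → ∀ ρ, e.resp s ≠ some (c, ρ) := by
    intro s
    induction s using Nat.strong_induction_on with
    | _ s ih => exact fun hs ρ h => hcon s ρ ⟨c, op, hev, hs, h, fun s' h1 h2 => ih s' h2 h1⟩
  have hmain : ∀ t, a < t → (client e t c).count = (client e (a + 1) c).count ∧
      (client e t c).phase ≠ .idle := by
    intro t ht
    induction t, ht using Nat.le_induction with
    | base => exact ⟨rfl, by rw [(invoke_spec he hev).2]; nofun⟩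
    | succ t ht ih =>
      cases client_move he c t with
      | stay hst => rwa [hst]
      | invoke op' hev' =>
        exact ((invoke_spec he hev').1 ⟨a, ht, ⟨op, hev⟩, fun s hs _ => hno s hs⟩).elim
      | hear _ _ _ _ _ _ _ _ _ hst => rw [hst]; exact ⟨ih.1, nofun⟩
      | commit _ _ _ _ _ hst => rw [hst]; exact ⟨ih.1, nofun⟩
      | ack _ _ _ _ _ _ _ _ hst => rw [hst]; exact ⟨ih.1, nofun⟩
      | finish _ _ _ _ _ _ hr => exact (hno t ht _ hr).elim
  obtain ⟨t₁, ht₁, hnq⟩ := query_phase_ends he hf hc R hR hRup fun t ht => (hmain t ht).1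
  have hstore : ∀ t, t₁ ≤ t → ∃ op x acked, (client e t c).phase = .store op x acked := by
    intro t ht
    induction t, ht using Nat.le_induction with
    | base =>
      cases hph : (client e t₁ c).phase with
      | idle => exact ((hmain t₁ ht₁).2 hph).elim
      | query => exact (hnq ⟨_, _, _, hph⟩).elim
      | store => exact ⟨_, _, _, rfl⟩
    | succ t ht ih =>
      obtain ⟨_, _, _, h⟩ := ih
      cases client_move he c t with
      | stay hst => rw [hst]; exact ⟨_, _, _, h⟩
      | invoke op' hev' =>
        exact ((invoke_spec he hev').1 ⟨a, by omega, ⟨op, hev⟩, fun s hs _ => hno s hs⟩).elim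
      | hear _ _ _ _ _ _ h0 => rw [h] at h0; cases h0
      | commit _ _ _ h0 => rw [h] at h0; cases h0
      | ack _ _ _ _ _ _ _ _ hst => rw [hst]; exact ⟨_, _, _, rfl⟩
      | finish _ _ _ _ _ _ hr => exact (hno t (by omega) _ hr).elim
  obtain ⟨t₂, ht₂, hns⟩ := store_phase_ends he hf (a := t₁) hc W hW hWup
    fun t ht => (hmain t (by omega)).1
  obtain ⟨_, _, _, h⟩ := hstore t₂ ht₂.le
  exact hns _ _ _ h

/-! ### Sufficiency of the bound -/

lemma le_card_compl_of_ncard_le {p : Fin n → Prop} [DecidablePred p] {m : ℕ}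
    (h : {i | p i}.ncard ≤ m) : n - m ≤ (Finset.univ.filter fun i => ¬ p i).card := by
  have h1 : {i | p i}.ncard = (Finset.univ.filter p).card := by
    rw [← Set.ncard_coe_finset]; simp
  have h2 := Finset.card_filter_add_card_filter_not (s := (Finset.univ : Finset (Fin n))) p
  rw [Finset.card_univ, Fintype.card_fin] at h2
  omega

lemma not_muted_of_no_lock {e : Run (quorumRegister n V v₀ false qr qw)} (he : e.IsExecution)
    (i : Fin n) (t : ℕ) : muted e t i = false := by
  induction t with
  | zero => unfold muted; rw [he.1]
  | succ t ih =>
    rcases replica_move he i t with ⟨h, -⟩ | ⟨-, h, -⟩ | ⟨_, -, -, h, -⟩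
    exacts [h.trans ih, h, h]

lemma not_muted_of_not_crash (he : e.IsExecution) {i : Fin n}
    (h : ¬ ∃ t, e.ev t = .crash (.replica i)) (t : ℕ) : muted e t i = false := by
  have hup : ∀ t, ¬ e.DownAt (.replica i) t := by
    rintro t ⟨t', -, h', -⟩; exact h ⟨t', h'⟩
  induction t with
  | zero => unfold muted; rw [he.1]
  | succ t ih =>
    have hv := he.2.2 t
    unfold Run.ValidStep at hv
    rcases replica_move he i t with ⟨h, -⟩ | ⟨hev, -⟩ | ⟨_, -, hev, -⟩
    · exact h.trans ih
    · rw [hev] at hv; exact (hup t hv.1).elim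
    · rw [hev] at hv; exact (hup t hv.1).elim

theorem exists_kTolerant (n k r b : ℕ) (V : Type) (v₀ : V)
    (h : 2 * k + r + 1 ≤ n ∨ 2 * k + b + 1 ≤ n) :
    ∃ A : RegImpl n V, A.KTolerant v₀ k r b := by
  classical
  rcases h with h | h
  · refine ⟨quorumRegister n V v₀ false (n - k) (n - k), fun e he hb => ⟨⟨fun t c ρ h =>
      pendingAt_of_resp he h, linearizableUpTo he (quorumsMeet_of_rollbackFaulty he hb.2.1
        (by omega))⟩, fun hf => waitFree he hf ?_ ?_⟩⟩
    · refine ⟨_, le_card_compl_of_ncard_le hb.1, fun i hi => ⟨?_, not_muted_of_no_lock he i⟩⟩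
      exact (not_not.1 (Finset.mem_filter.1 hi).2).1
    · refine ⟨_, le_card_compl_of_ncard_le hb.1, fun i hi => ?_⟩
      exact (not_not.1 (Finset.mem_filter.1 hi).2).1
  · refine ⟨quorumRegister n V v₀ true (n - (k + b)) (n - k), fun e he hb => ⟨⟨fun t c ρ h =>
      pendingAt_of_resp he h, linearizableUpTo he (quorumsMeet_of_lock he
        (by omega))⟩, fun hf => waitFree he hf ?_ ?_⟩⟩
    · have : {i | e.Faulty i ∨ e.Benign i}.ncard ≤ k + b :=
        (Set.ncard_union_le {i | e.Faulty i} {i | e.Benign i}).trans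
          (add_le_add hb.1 hb.2.2)
      refine ⟨_, le_card_compl_of_ncard_le this, fun i hi => ?_⟩
      have hi := (Finset.mem_filter.1 hi).2
      rw [not_or] at hi
      have hcor : e.CorrectReplica i := not_not.1 hi.1
      exact ⟨hcor.1, not_muted_of_not_crash he fun hcr => hi.2 ⟨hcor, hcr⟩⟩
    · refine ⟨_, le_card_compl_of_ncard_le hb.1, fun i hi => ?_⟩
      exact (not_not.1 (Finset.mem_filter.1 hi).2).1

end CRR

namespace CRR

variable {n : ℕ} {V : Type} {A : RegImpl n V}

/-! ### Runs that follow a schedule -/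

/-- What a scheduler has to know: the local states, the messages sent at each time so far, and which
of them have been delivered. -/
structure Snapshot (A : RegImpl n V) : Type where
  rep : Fin n → A.Vol × A.NonVol
  cl : ℕ → A.Cl
  log : ℕ → List (Packet n A.Msg)
  done : Set (ℕ × ℕ)

/-- The effect of an event: new local states, messages sent, and response. -/
structure Effect (A : RegImpl n V) : Type where
  rep : Fin n → A.Vol × A.NonVol
  cl : ℕ → A.Cl
  sent : List (Packet n A.Msg)
  resp : Option (ℕ × RegResp V)

/-- The effect of an atomic action, with nondeterminism resolved by choice. -/
noncomputable def Snapshot.act (S : Snapshot A) (p : Proc n) (inp : Input n A.Msg) : Effect A :=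
  match p with
  | .replica i =>
    let o := (A.replicaStep_nonempty i (S.rep i) inp).some
    ⟨Function.update S.rep i o.1, S.cl, o.2.map (fun d => ⟨.replica i, d.1, d.2⟩), none⟩
  | .client c =>
    let o := (A.clientStep_nonempty c (S.cl c) inp).some
    ⟨S.rep, Function.update S.cl c o.1, o.2.1.map (fun d => ⟨.client c, d.1, d.2⟩),
      o.2.2.map (fun x => (c, x))⟩

/-- The effect of an event. Rollbacks are never scheduled, and have no effect here. -/
noncomputable def Snapshot.effect (S : Snapshot A) : Event n V → Effect A
  | .tick p => S.act p .tick
  | .deliver s j =>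
    match (S.log s)[j]? with
    | some pk => S.act pk.dst (.recv pk.src pk.msg)
    | none => ⟨S.rep, S.cl, [], none⟩
  | .invoke c op =>
    let o := (A.clientInvoke_nonempty c (S.cl c) op).some
    ⟨S.rep, Function.update S.cl c o.1, o.2.map (fun d => ⟨.client c, d.1, d.2⟩), none⟩
  | .restart i =>
    ⟨Function.update S.rep i (A.replicaRestart_nonempty i (S.rep i).2).some, S.cl, [], none⟩
  | _ => ⟨S.rep, S.cl, [], none⟩

open Classical in
/-- A scheduled delivery takes place only if there is such a message, it has not been delivered yet,
and its recipient is in `ok`. -/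
noncomputable def Snapshot.filter (S : Snapshot A) (ok : Proc n → Prop) (t : ℕ) :
    Event n V → Event n V
  | .deliver s j =>
    if s < t ∧ (s, j) ∉ S.done ∧ ∃ pk, (S.log s)[j]? = some pk ∧ ok pk.dst then .deliver s j
    else .idle
  | x => x

/-- The snapshots of the run that follows the schedule. -/
noncomputable def snapshot (A : RegImpl n V) (ok : Proc n → Prop) (sched : ℕ → Event n V) :
    ℕ → Snapshot A
  | 0 => ⟨A.replicaStart, A.clientStart, fun _ => [], ∅⟩
  | t + 1 =>
    let S := snapshot A ok sched t
    let x := S.filter ok t (sched t)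
    ⟨(S.effect x).rep, (S.effect x).cl, Function.update S.log t (S.effect x).sent,
      S.done ∪ {d | x = .deliver d.1 d.2}⟩

/-- The run that follows the schedule. -/
noncomputable def scheduledRun (A : RegImpl n V) (cls : Finset ℕ) (ok : Proc n → Prop)
    (sched : ℕ → Event n V) : Run A where
  clients := cls
  rep t := (snapshot A ok sched t).rep
  cl t := (snapshot A ok sched t).cl
  ev t := (snapshot A ok sched t).filter ok t (sched t)
  sent t := ((snapshot A ok sched t).effect ((snapshot A ok sched t).filter ok t (sched t))).sent
  resp t := ((snapshot A ok sched t).effect ((snapshot A ok sched t).filter ok t (sched t))).resp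

variable {cls : Finset ℕ} {ok : Proc n → Prop} {sched : ℕ → Event n V}

lemma snapshot_log {s t : ℕ} (h : s < t) :
    (snapshot A ok sched t).log s = (scheduledRun A cls ok sched).sent s := by
  induction t, h using Nat.le_induction with
  | base => simp [snapshot, scheduledRun]
  | succ t h ih =>
    rw [← ih]
    simp only [snapshot]
    rw [Function.update_of_ne (by omega)]

lemma mem_snapshot_done {s j t : ℕ} :
    (s, j) ∈ (snapshot A ok sched t).done ↔
      ∃ t' < t, (scheduledRun A cls ok sched).ev t' = .deliver s j := by
  induction t with
  | zero => simp [snapshot]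
  | succ t ih =>
    simp only [snapshot, Set.mem_union, ih, Set.mem_ofPred_eq]
    constructor
    · rintro (⟨t', h1, h2⟩ | h)
      · exact ⟨t', by omega, h2⟩
      · exact ⟨t, by omega, h⟩
    · rintro ⟨t', h1, h2⟩
      rcases Nat.lt_succ_iff_lt_or_eq.1 h1 with h | rfl
      exacts [Or.inl ⟨t', h, h2⟩, Or.inr h2]

lemma scheduledRun_ev (t : ℕ) : (scheduledRun A cls ok sched).ev t = sched t ∨
    (∃ s j, sched t = .deliver s j) ∧ (scheduledRun A cls ok sched).ev t = .idle := by
  simp only [scheduledRun]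
  cases hx : sched t with
  | deliver s j =>
    simp only [Snapshot.filter]
    split_ifs
    exacts [Or.inl rfl, Or.inr ⟨⟨s, j, rfl⟩, rfl⟩]
  | _ => exact Or.inl rfl

lemma deliverable_of_ev {s j t : ℕ} (h : (scheduledRun A cls ok sched).ev t = .deliver s j) :
    s < t ∧ (∀ t' < t, (scheduledRun A cls ok sched).ev t' ≠ .deliver s j) ∧
    ∃ pk, ((scheduledRun A cls ok sched).sent s)[j]? = some pk ∧ ok pk.dst := by
  have h' : (snapshot A ok sched t).filter ok t (sched t) = .deliver s j := h
  cases hx : sched t with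
  | deliver s' j' =>
    rw [hx] at h'
    simp only [Snapshot.filter] at h'
    split_ifs at h' with hc
    cases h'
    obtain ⟨h1, h2, h3⟩ := hc
    rw [mem_snapshot_done (cls := cls)] at h2
    rw [snapshot_log (cls := cls) h1] at h3
    push Not at h2
    exact ⟨h1, h2, h3⟩
  | _ => rw [hx] at h'; cases h'

lemma deliver_of_sched {s j t : ℕ} (h : sched t = .deliver s j) (hs : s < t)
    {pk : Packet n A.Msg} (hpk : ((scheduledRun A cls ok sched).sent s)[j]? = some pk)
    (hok : ok pk.dst) : ∃ t', (scheduledRun A cls ok sched).ev t' = .deliver s j := by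
  by_contra! hcon
  refine hcon t ?_
  simp only [scheduledRun, h, Snapshot.filter]
  rw [if_pos]
  refine ⟨hs, ?_, pk, by rw [snapshot_log (cls := cls) hs]; exact hpk, hok⟩
  rw [mem_snapshot_done (cls := cls)]
  rintro ⟨t', -, h'⟩
  exact hcon t' h'

lemma scheduledRun_acts {t : ℕ} {p : Proc n} {inp : Input n A.Msg}
    (h : (snapshot A ok sched t).effect ((scheduledRun A cls ok sched).ev t) =
      (snapshot A ok sched t).act p inp) : (scheduledRun A cls ok sched).Acts t p inp := by
  have h' : (snapshot A ok sched t).effect ((snapshot A ok sched t).filter ok t (sched t)) =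
    (snapshot A ok sched t).act p inp := h
  cases p with
  | replica i =>
    have hm := (A.replicaStep_nonempty i ((snapshot A ok sched t).rep i) inp).some_mem
    refine ⟨(A.replicaStep_nonempty i ((snapshot A ok sched t).rep i) inp).some.1,
      (A.replicaStep_nonempty i ((snapshot A ok sched t).rep i) inp).some.2, hm, ?_, ?_, ?_, ?_⟩ <;>
    · simp only [scheduledRun, snapshot, h', Snapshot.act]
  | client c =>
    have hm := (A.clientStep_nonempty c ((snapshot A ok sched t).cl c) inp).some_mem
    refine ⟨(A.clientStep_nonempty c ((snapshot A ok sched t).cl c) inp).some.1,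
      (A.clientStep_nonempty c ((snapshot A ok sched t).cl c) inp).some.2.1,
      (A.clientStep_nonempty c ((snapshot A ok sched t).cl c) inp).some.2.2, hm, ?_, ?_, ?_, ?_⟩ <;>
    · simp only [scheduledRun, snapshot, h', Snapshot.act]

/-- A step of a scheduled run is valid if the schedule respects the failure model. -/
lemma scheduledRun_validStep {t : ℕ}
    (h : match (scheduledRun A cls ok sched).ev t with
      | .idle => True
      | .tick p => (scheduledRun A cls ok sched).Present p ∧ (scheduledRun A cls ok sched).UpAt p t
      | .deliver _ _ => ∀ p, ok p →
          (scheduledRun A cls ok sched).Present p ∧ (scheduledRun A cls ok sched).UpAt p t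
      | .invoke c _ => c ∈ cls ∧ (scheduledRun A cls ok sched).UpAt (.client c) t ∧
          ¬ (scheduledRun A cls ok sched).PendingAt c t
      | .crash p => (scheduledRun A cls ok sched).Present p ∧ (scheduledRun A cls ok sched).UpAt p t
      | .restart i => (scheduledRun A cls ok sched).DownAt (.replica i) t
      | .rollback _ _ => False) : (scheduledRun A cls ok sched).ValidStep t := by
  unfold Run.ValidStep
  cases hx : (scheduledRun A cls ok sched).ev t with
  | rollback i s => rw [hx] at h; exact h.elim
  | tick p =>
    rw [hx] at h
    exact ⟨h.1, h.2, scheduledRun_acts (by rw [hx]; rfl)⟩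
  | deliver s j =>
    rw [hx] at h
    obtain ⟨h1, h2, pk, hpk, hok⟩ := deliverable_of_ev hx
    refine ⟨pk, h1, hpk, h2, (h _ hok).1, (h _ hok).2, scheduledRun_acts ?_⟩
    rw [hx]
    simp only [Snapshot.effect]
    rw [snapshot_log (cls := cls) h1, hpk]
  | idle =>
    have hx' : (snapshot A ok sched t).filter ok t (sched t) = .idle := hx
    refine ⟨?_, ?_, ?_, ?_⟩ <;> simp only [scheduledRun, snapshot, hx', Snapshot.effect]
  | crash p =>
    rw [hx] at h
    have hx' : (snapshot A ok sched t).filter ok t (sched t) = .crash p := hx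
    refine ⟨h.1, h.2, ?_, ?_, ?_, ?_⟩ <;> simp only [scheduledRun, snapshot, hx', Snapshot.effect]
  | restart i =>
    rw [hx] at h
    have hx' : (snapshot A ok sched t).filter ok t (sched t) = .restart i := hx
    refine ⟨h, ⟨?_, ?_, ?_⟩, _, (A.replicaRestart_nonempty i _).some_mem, ?_⟩ <;>
    · simp only [scheduledRun, snapshot, hx', Snapshot.effect]
  | invoke c op =>
    rw [hx] at h
    have hx' : (snapshot A ok sched t).filter ok t (sched t) = .invoke c op := hx
    have hm := (A.clientInvoke_nonempty c ((snapshot A ok sched t).cl c) op).some_mem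
    refine ⟨h.1, h.2.1, h.2.2,
      (A.clientInvoke_nonempty c ((snapshot A ok sched t).cl c) op).some.1,
      (A.clientInvoke_nonempty c ((snapshot A ok sched t).cl c) op).some.2, hm, ?_, ?_, ?_, ?_⟩ <;>
    · simp only [scheduledRun, snapshot, hx', Snapshot.effect]

/-! ### Runs with a single operation -/

/-- The processes that are active in a run in which only client `c` invokes an operation and the
replicas in `X` crash for good. -/
def Active (c : ℕ) (X : Finset (Fin n)) : Proc n → Prop
  | .replica i => i ∉ X
  | .client c' => c' = c

/-- The events of a run with a single operation `op`, of client `c`: first the replicas in `X` and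
in `C` crash, then those in `C` restart, then `op` is invoked, and then the active processes
take steps. -/
structure Solo (e : Run A) (c : ℕ) (op : RegOp V) (X C : Finset (Fin n)) : Prop where
  disjoint : Disjoint X C
  clients : e.clients = {c}
  crash : ∀ i : Fin n, e.ev i = if i ∈ X ∪ C then .crash (.replica i) else .idle
  restart : ∀ i : Fin n, e.ev (n + i) = if i ∈ C then .restart i else .idle
  invoke : e.ev (2 * n) = .invoke c op
  later : ∀ t, 2 * n < t → e.ev t = .idle ∨ (∃ p, Active c X p ∧ e.ev t = .tick p) ∨
    ∃ s j pk, e.ev t = .deliver s j ∧ (e.sent s)[j]? = some pk ∧ Active c X pk.dst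

namespace Solo

variable {e : Run A} {c : ℕ} {op : RegOp V} {X C : Finset (Fin n)}

lemma cases_ev (h : Solo e c op X C) (t : ℕ) :
    (∃ i : Fin n, t = i ∧ i ∈ X ∪ C ∧ e.ev t = .crash (.replica i)) ∨
    (∃ i : Fin n, t = n + i ∧ i ∈ C ∧ e.ev t = .restart i) ∨
    (t = 2 * n ∧ e.ev t = .invoke c op) ∨
    ((t < 2 * n ∧ ∀ i ∈ C, t ≠ n + i) ∧ e.ev t = .idle) ∨
    2 * n < t ∧ (e.ev t = .idle ∨ (∃ p, Active c X p ∧ e.ev t = .tick p) ∨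
      ∃ s j pk, e.ev t = .deliver s j ∧ (e.sent s)[j]? = some pk ∧ Active c X pk.dst) := by
  rcases lt_or_ge t n with h1 | h1
  · have h2 := h.crash ⟨t, h1⟩
    simp only at h2
    split_ifs at h2 with h3
    · exact Or.inl ⟨⟨t, h1⟩, rfl, h3, h2⟩
    · exact Or.inr (Or.inr (Or.inr (Or.inl ⟨⟨by omega, fun i _ => by omega⟩, h2⟩)))
  rcases lt_trichotomy t (2 * n) with h4 | h4 | h4
  · have h2 := h.restart ⟨t - n, by omega⟩
    simp only [show n + (t - n) = t by omega] at h2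
    split_ifs at h2 with h3
    · exact Or.inr (Or.inl ⟨⟨t - n, by omega⟩, by simp only; omega, h3, h2⟩)
    · refine Or.inr (Or.inr (Or.inr (Or.inl ⟨⟨by omega, fun i hi hti => h3 ?_⟩, h2⟩)))
      convert hi
      omega
  · exact Or.inr (Or.inr (Or.inl ⟨h4, h4 ▸ h.invoke⟩))
  · exact Or.inr (Or.inr (Or.inr (Or.inr ⟨h4, h.later t h4⟩)))

lemma of_crash (h : Solo e c op X C) {t : ℕ} {p : Proc n} (hp : e.ev t = .crash p) :
    ∃ i : Fin n, t = i ∧ i ∈ X ∪ C ∧ p = .replica i := by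
  rcases h.cases_ev t with ⟨i, h1, h2, h3⟩ | ⟨i, h1, h2, h3⟩ | ⟨h1, h3⟩ | ⟨h1, h3⟩ |
    ⟨h1, h3 | ⟨p, h2, h3⟩ | ⟨s, j, pk, h3, -⟩⟩ <;> rw [hp] at h3 <;> cases h3
  exact ⟨i, h1, h2, rfl⟩

lemma of_restart (h : Solo e c op X C) {t : ℕ} {i : Fin n} (hp : e.ev t = .restart i) :
    t = n + i ∧ i ∈ C := by
  rcases h.cases_ev t with ⟨i, h1, h2, h3⟩ | ⟨i, h1, h2, h3⟩ | ⟨h1, h3⟩ | ⟨h1, h3⟩ |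
    ⟨h1, h3 | ⟨p, h2, h3⟩ | ⟨s, j, pk, h3, -⟩⟩ <;> rw [hp] at h3 <;> cases h3
  exact ⟨h1, h2⟩

lemma of_invoke (h : Solo e c op X C) {t c' : ℕ} {op' : RegOp V} (hp : e.ev t = .invoke c' op') :
    t = 2 * n ∧ c' = c ∧ op' = op := by
  rcases h.cases_ev t with ⟨i, h1, h2, h3⟩ | ⟨i, h1, h2, h3⟩ | ⟨h1, h3⟩ | ⟨h1, h3⟩ |
    ⟨h1, h3 | ⟨p, h2, h3⟩ | ⟨s, j, pk, h3, -⟩⟩ <;> rw [hp] at h3 <;> cases h3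
  exact ⟨h1, rfl, rfl⟩

lemma of_tick (h : Solo e c op X C) {t : ℕ} {p : Proc n} (hp : e.ev t = .tick p) :
    2 * n < t ∧ Active c X p := by
  rcases h.cases_ev t with ⟨i, h1, h2, h3⟩ | ⟨i, h1, h2, h3⟩ | ⟨h1, h3⟩ | ⟨h1, h3⟩ |
    ⟨h1, h3 | ⟨p, h2, h3⟩ | ⟨s, j, pk, h3, -⟩⟩ <;> rw [hp] at h3 <;> cases h3
  exact ⟨h1, h2⟩

lemma of_deliver (h : Solo e c op X C) {t s j : ℕ} (hp : e.ev t = .deliver s j) :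
    2 * n < t ∧ ∃ pk, (e.sent s)[j]? = some pk ∧ Active c X pk.dst := by
  rcases h.cases_ev t with ⟨i, h1, h2, h3⟩ | ⟨i, h1, h2, h3⟩ | ⟨h1, h3⟩ | ⟨h1, h3⟩ |
    ⟨h1, h3 | ⟨p, h2, h3⟩ | ⟨s, j, pk, h3, h4⟩⟩ <;> rw [hp] at h3 <;> cases h3
  exact ⟨h1, pk, h4⟩

lemma not_rollback (h : Solo e c op X C) {t s : ℕ} {i : Fin n} : e.ev t ≠ .rollback i s := by
  intro hp
  rcases h.cases_ev t with ⟨i, h1, h2, h3⟩ | ⟨i, h1, h2, h3⟩ | ⟨h1, h3⟩ | ⟨h1, h3⟩ |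
    ⟨h1, h3 | ⟨p, h2, h3⟩ | ⟨s, j, pk, h3, h4⟩⟩ <;> rw [hp] at h3 <;> cases h3

lemma upAt_client (h : Solo e c op X C) (c' t : ℕ) : e.UpAt (.client c') t := by
  rintro ⟨t', -, h1, -⟩
  obtain ⟨_, -, -, h2⟩ := h.of_crash h1
  cases h2

lemma upAt_replica (h : Solo e c op X C) {i : Fin n} (hi : i ∉ X) {t : ℕ}
    (ht : i ∈ C → t ≤ i ∨ n + i < t) : e.UpAt (.replica i) t := by
  rintro ⟨t', ht', h1, h2⟩
  obtain ⟨i', rfl, h3, h4⟩ := h.of_crash h1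
  cases h4
  have hiC : i ∈ C := by simpa [hi] using h3
  rcases ht hiC with h5 | h5
  · omega
  · refine h2 (n + i) (by have := i.2; omega) h5 ⟨i, rfl, Or.inl ?_⟩
    rw [h.restart, if_pos hiC]

lemma upAt_active (h : Solo e c op X C) {p : Proc n} (hp : Active c X p) {t : ℕ}
    (ht : 2 * n ≤ t) : e.UpAt p t := by
  cases p with
  | client c' => exact h.upAt_client c' t
  | replica i => exact h.upAt_replica hp fun _ => Or.inr (by have := i.2; omega)

lemma present_active (h : Solo e c op X C) {p : Proc n} (hp : Active c X p) : e.Present p := by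
  cases p with
  | client c' =>
    have : c' = c := hp
    subst this
    simp [Run.Present, h.clients]
  | replica i => trivial

lemma not_eventuallyUp (h : Solo e c op X C) {i : Fin n} (hi : i ∈ X) :
    ¬ e.EventuallyUp (.replica i) := by
  rintro ⟨T, hT⟩
  refine hT (T + i + 1) (by omega) ⟨i, by omega, ?_, fun s _ _ => ?_⟩
  · rw [h.crash, if_pos (Finset.mem_union_left _ hi)]
  · rintro ⟨i', h1, h2 | ⟨s', h2⟩⟩
    · cases h1
      exact Finset.disjoint_left.1 h.disjoint hi (h.of_restart h2).2
    · exact h.not_rollback h2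

lemma correctClient (h : Solo e c op X C) : e.CorrectClient c := by
  refine ⟨by simp [h.clients], fun t ht => ?_⟩
  obtain ⟨_, -, -, h2⟩ := h.of_crash ht
  cases h2

lemma correctReplica (h : Solo e c op X C) {i : Fin n} (hi : i ∉ X) : e.CorrectReplica i :=
  ⟨⟨2 * n, fun _ ht => h.upAt_active (p := .replica i) hi ht⟩, fun ⟨_, _, h'⟩ => h.not_rollback h'⟩

/-- Only the replicas in `X` are faulty, and only those in `C` are benign. -/
lemma withinBounds (h : Solo e c op X C) {k b : ℕ} (r : ℕ) (hX : X.card ≤ k) (hC : C.card ≤ b) :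
    e.WithinBounds k r b := by
  refine ⟨?_, ?_, ?_⟩
  · rw [← Set.ncard_coe_finset] at hX
    refine (Set.ncard_le_ncard fun i hi => ?_).trans hX
    by_contra hiX
    exact hi (h.correctReplica hiX)
  · have : {i | e.RollbackFaulty i} = ∅ := by
      ext i
      simp only [Set.mem_ofPred_eq, Set.mem_empty_iff_false, iff_false]
      rintro ⟨-, _, _, h'⟩
      exact h.not_rollback h'
    rw [this]; simp
  · rw [← Set.ncard_coe_finset] at hC
    refine (Set.ncard_le_ncard fun i hi => ?_).trans hC
    obtain ⟨⟨⟨T, hT⟩, hrb⟩, t, ht⟩ := hi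
    obtain ⟨i', rfl, h1, h2⟩ := h.of_crash ht
    cases h2
    by_contra hiC
    have hiX : i ∈ X := by
      rcases Finset.mem_union.1 h1 with h | h
      exacts [h, (hiC h).elim]
    refine hT (T + i + 1) (by omega) ⟨i, by omega, ht, fun s _ _ => ?_⟩
    rintro ⟨i', h1, h2 | ⟨s', h2⟩⟩
    · cases h1
      exact hiC (h.of_restart h2).2
    · exact h.not_rollback h2

end Solo

/-- The recurring tasks of a fair scheduler, in an arbitrary enumeration: local steps of the client
(`inl none`) and of the replicas, and deliveries. -/
noncomputable def fairTask (c : ℕ) (X : Finset (Fin n)) (t : ℕ) : Event n V :=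
  match (Encodable.decode t.unpair.1 : Option (Option (Fin n) ⊕ ℕ × ℕ)) with
  | some (.inl none) => .tick (.client c)
  | some (.inl (some i)) => if i ∈ X then .idle else .tick (.replica i)
  | some (.inr (s, j)) => .deliver s j
  | none => .idle

lemma exists_ge_decode (x : Option (Fin n) ⊕ ℕ × ℕ) (T : ℕ) : ∃ t, T ≤ t ∧
    (Encodable.decode t.unpair.1 : Option (Option (Fin n) ⊕ ℕ × ℕ)) = some x :=
  ⟨Nat.pair (Encodable.encode x) T, Nat.right_le_pair _ _, by simp⟩

/-- A schedule for a fair run with a single operation. -/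
noncomputable def soloSchedule (c : ℕ) (op : RegOp V) (X C : Finset (Fin n)) (t : ℕ) : Event n V :=
  if h : t < n then (if (⟨t, h⟩ : Fin n) ∈ X ∪ C then .crash (.replica ⟨t, h⟩) else .idle)
  else if h : t - n < n then (if (⟨t - n, h⟩ : Fin n) ∈ C then .restart ⟨t - n, h⟩ else .idle)
  else if t = 2 * n then .invoke c op
  else fairTask c X t

/-- Every implementation has a fair run with a single operation. -/
theorem exists_solo (A : RegImpl n V) (c : ℕ) (op : RegOp V) (X C : Finset (Fin n))
    (hXC : Disjoint X C) : ∃ e : Run A, e.IsExecution ∧ e.Fair ∧ Solo e c op X C := by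
  let e := scheduledRun A {c} (Active c X) (soloSchedule c op X C)
  have hev : ∀ t, e.ev t = soloSchedule c op X C t ∨
    (∃ s j, soloSchedule c op X C t = .deliver s j) ∧ e.ev t = .idle := scheduledRun_ev
  have hlate : ∀ t, 2 * n < t → soloSchedule c op X C t = fairTask c X t := fun t ht => by
    unfold soloSchedule
    rw [dif_neg (by omega), dif_neg (by omega), if_neg (by omega)]
  have hs : Solo e c op X C := by
    refine ⟨hXC, rfl, fun i => ?_, fun i => ?_, ?_, fun t ht => ?_⟩
    · have h1 := hev i
      simp only [soloSchedule, i.2, dif_pos, Fin.eta] at h1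
      rcases h1 with h1 | ⟨⟨s, j, h1⟩, -⟩
      · exact h1
      · split_ifs at h1
    · have h1 := hev (n + i)
      simp only [soloSchedule, show ¬ (n + i < n) by omega, dif_neg, not_false_eq_true,
        show n + (i : ℕ) - n = i by omega, i.2, dif_pos, Fin.eta] at h1
      rcases h1 with h1 | ⟨⟨s, j, h1⟩, -⟩
      · exact h1
      · split_ifs at h1
    · have h1 := hev (2 * n)
      have h2 : soloSchedule c op X C (2 * n) = .invoke c op := by
        unfold soloSchedule
        rw [dif_neg (by omega), dif_neg (by omega), if_pos rfl]
      rw [h2] at h1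
      rcases h1 with h1 | ⟨⟨s, j, h1⟩, -⟩
      · exact h1
      · cases h1
    · rcases hev t with h1 | h1
      · rw [hlate t ht, fairTask] at h1
        split at h1
        · exact Or.inr (Or.inl ⟨.client c, rfl, h1⟩)
        · split_ifs at h1 with hi
          · exact Or.inl h1
          · exact Or.inr (Or.inl ⟨.replica _, hi, h1⟩)
        · obtain ⟨-, -, pk, hpk, hok⟩ := deliverable_of_ev h1
          exact Or.inr (Or.inr ⟨_, _, pk, h1, hpk, hok⟩)
        · exact Or.inl h1
      · exact Or.inl h1.2
  refine ⟨e, ⟨rfl, rfl, fun t => scheduledRun_validStep ?_⟩, ⟨fun p hp hup T => ?_,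
    fun p q hp hq T hT s hs' j m hj => ?_⟩, hs⟩
  · change match e.ev t with
      | .idle => True
      | .tick p => e.Present p ∧ e.UpAt p t
      | .deliver _ _ => ∀ p, Active c X p → e.Present p ∧ e.UpAt p t
      | .invoke c' _ => c' ∈ ({c} : Finset ℕ) ∧ e.UpAt (.client c') t ∧ ¬ e.PendingAt c' t
      | .crash p => e.Present p ∧ e.UpAt p t
      | .restart i => e.DownAt (.replica i) t
      | .rollback _ _ => False
    cases hx : e.ev t with
    | idle => trivial
    | tick p =>
      obtain ⟨h1, h2⟩ := hs.of_tick hx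
      exact ⟨hs.present_active h2, hs.upAt_active h2 h1.le⟩
    | deliver s j =>
      obtain ⟨h1, -⟩ := hs.of_deliver hx
      exact fun p hp => ⟨hs.present_active hp, hs.upAt_active hp h1.le⟩
    | invoke c' op' =>
      obtain ⟨rfl, rfl, rfl⟩ := hs.of_invoke hx
      refine ⟨by simp, hs.upAt_client _ _, ?_⟩
      rintro ⟨t', ht', ⟨op'', h1⟩, -⟩
      have := (hs.of_invoke h1).1
      omega
    | crash p =>
      obtain ⟨i, rfl, h1, rfl⟩ := hs.of_crash hx
      refine ⟨trivial, ?_⟩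
      rintro ⟨t', ht', h2, -⟩
      obtain ⟨i', rfl, -, h3⟩ := hs.of_crash h2
      cases h3
      omega
    | restart i =>
      obtain ⟨rfl, h1⟩ := hs.of_restart hx
      refine ⟨i, by have := i.2; omega, ?_, fun s _ hs' => ?_⟩
      · rw [hs.crash, if_pos (Finset.mem_union_right _ h1)]
      · rintro ⟨i', h2, h3 | ⟨s', h3⟩⟩
        · cases h2
          have := (hs.of_restart h3).1
          omega
        · exact hs.not_rollback h3
    | rollback i s => exact hs.not_rollback hx
  · have hact : ∀ p : Proc n, e.Present p → e.EventuallyUp p → ∃ x : Option (Fin n), ∀ t,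
        (Encodable.decode t.unpair.1 : Option (Option (Fin n) ⊕ ℕ × ℕ)) = some (.inl x) →
        (fairTask c X t : Event n V) = .tick p := by
      intro p hp hup
      cases p with
      | client c' =>
        have : c' = c := by simpa [Run.Present, hs.clients] using hp
        exact ⟨none, fun t ht => by rw [fairTask, ht, this]⟩
      | replica i =>
        have : i ∉ X := fun hi => hs.not_eventuallyUp hi hup
        exact ⟨some i, fun t ht => by rw [fairTask, ht]; simp [this]⟩
    obtain ⟨x, hx⟩ := hact p hp hup
    obtain ⟨t, ht, htx⟩ := exists_ge_decode (n := n) (.inl x) (T + 2 * n + 1)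
    refine ⟨t, by omega, ?_⟩
    have h1 := hev t
    rw [hlate t (by omega), hx t htx] at h1
    rcases h1 with h1 | ⟨⟨s, j, h1⟩, -⟩
    · exact h1
    · cases h1
  · obtain ⟨t, ht, htx⟩ := exists_ge_decode (n := n) (.inr (s, j)) (s + 2 * n + 1)
    have hact : Active c X q := by
      cases q with
      | client c' => simpa [Run.Present, hs.clients, Active] using hq
      | replica i =>
        exact fun hi => hs.not_eventuallyUp hi ⟨T, fun t ht => (hT t ht).2⟩
    refine deliver_of_sched (t := t) (pk := ⟨p, q, m⟩) ?_ (by omega) hj hact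
    rw [hlate t (by omega), fairTask, htx]

namespace Solo

variable {e : Run A} {c : ℕ} {op : RegOp V} {X C : Finset (Fin n)}

lemma rep_succ (h : Solo e c op X C) (he : e.IsExecution) {t : ℕ} {i : Fin n}
    (ht : i ∈ X ∨ t < 2 * n ∧ ¬ (i ∈ C ∧ t = n + i)) : e.rep (t + 1) i = e.rep t i := by
  have hv := he.2.2 t
  have hact : ∀ {p : Proc n} {inp : Input n A.Msg}, Active c X p → 2 * n < t → e.Acts t p inp →
      e.rep (t + 1) i = e.rep t i := by
    intro p inp hp hlt ha
    cases p with
    | client c' => obtain ⟨_, _, _, -, h1, -⟩ := ha; rw [h1]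
    | replica i' =>
      obtain ⟨_, _, -, h1, -⟩ := ha
      rw [h1, Function.update_of_ne]
      rintro rfl
      rcases ht with ht | ht
      · exact hp ht
      · omega
  unfold Run.ValidStep at hv
  cases hx : e.ev t with
  | idle => rw [hx] at hv; rw [hv.1]
  | crash p => rw [hx] at hv; rw [hv.2.2.1]
  | invoke c' op' => rw [hx] at hv; obtain ⟨-, -, -, _, _, -, h1, -⟩ := hv; rw [h1]
  | rollback i' s => exact (h.not_rollback hx).elim
  | tick p =>
    rw [hx] at hv
    obtain ⟨h1, h2⟩ := h.of_tick hx
    exact hact h2 h1 hv.2.2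
  | deliver s j =>
    rw [hx] at hv
    obtain ⟨h1, pk, hpk, h2⟩ := h.of_deliver hx
    obtain ⟨pk', -, hpk', -, -, -, ha⟩ := hv
    rw [hpk] at hpk'
    cases hpk'
    exact hact h2 h1 ha
  | restart i' =>
    rw [hx] at hv
    obtain ⟨h1, h2⟩ := h.of_restart hx
    obtain ⟨-, -, _, -, h3⟩ := hv
    by_cases hi : i = i'
    · subst hi
      rcases ht with ht | ht
      · exact (Finset.disjoint_left.1 h.disjoint ht h2).elim
      · exact (ht.2 ⟨h2, h1⟩).elim
    · rw [h3, Function.update_of_ne hi]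

lemma rep_crashed (h : Solo e c op X C) (he : e.IsExecution) {i : Fin n} (hi : i ∈ X) (t : ℕ) :
    e.rep t i = A.replicaStart i := by
  induction t with
  | zero => rw [he.1]
  | succ t ih => rw [h.rep_succ he (Or.inl hi), ih]

lemma rep_restarting (h : Solo e c op X C) (he : e.IsExecution) {i : Fin n} {t : ℕ}
    (ht : t ≤ n + i) : e.rep t i = A.replicaStart i := by
  induction t with
  | zero => rw [he.1]
  | succ t ih =>
    have := i.2
    rw [h.rep_succ he (Or.inr ⟨by omega, by omega⟩), ih (by omega)]

lemma cl_other (h : Solo e c op X C) (he : e.IsExecution) {c' : ℕ} (hc : c' ≠ c) (t : ℕ) :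
    e.cl t c' = A.clientStart c' := by
  induction t with
  | zero => rw [he.2.1]
  | succ t ih =>
    rw [← ih]
    have hv := he.2.2 t
    have hact : ∀ {p : Proc n} {inp : Input n A.Msg}, Active c X p → e.Acts t p inp →
        e.cl (t + 1) c' = e.cl t c' := by
      intro p inp hp ha
      cases p with
      | client c'' =>
        obtain ⟨_, _, _, -, -, h1, -⟩ := ha
        have : c'' = c := hp
        rw [h1, Function.update_of_ne (this ▸ hc)]
      | replica i => obtain ⟨_, _, -, -, h1, -⟩ := ha; rw [h1]
    unfold Run.ValidStep at hv
    cases hx : e.ev t with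
    | idle => rw [hx] at hv; rw [hv.2.1]
    | crash p => rw [hx] at hv; rw [hv.2.2.2.1]
    | restart i => rw [hx] at hv; rw [hv.2.1.1]
    | rollback i s => exact (h.not_rollback hx).elim
    | invoke c'' op' =>
      rw [hx] at hv
      obtain ⟨-, rfl, -⟩ := h.of_invoke hx
      obtain ⟨-, -, -, _, _, -, -, h1, -⟩ := hv
      rw [h1, Function.update_of_ne hc]
    | tick p =>
      rw [hx] at hv
      exact hact (h.of_tick hx).2 hv.2.2
    | deliver s j =>
      rw [hx] at hv
      obtain ⟨h1, pk, hpk, h2⟩ := h.of_deliver hx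
      obtain ⟨pk', -, hpk', -, -, -, ha⟩ := hv
      rw [hpk] at hpk'
      cases hpk'
      exact hact h2 ha

/-- In a run that is linearizable, a read that is the only operation returns the initial value. -/
lemma read_returns_initial {v₀ : V} (h : Solo e c .read X C) (hat : e.Atomic v₀) {t : ℕ}
    {ρ : RegResp V} (hret : e.Returns (2 * n) t ρ) : ρ = .value v₀ := by
  obtain ⟨L, -, -, hL, -, hleg⟩ := hat.2 (t + 1)
  have hmem := hL _ t (Nat.lt_succ_self t) ρ hret
  cases L with
  | nil => cases hmem
  | cons a l =>
    have ha : a = 2 * n := by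
      unfold Run.Legal at hleg
      cases hx : e.ev a with
      | invoke c' op => exact (h.of_invoke hx).1
      | _ => rw [hx] at hleg; exact hleg.elim
    subst ha
    unfold Run.Legal at hleg
    rw [h.invoke] at hleg
    exact hleg.1 t (Nat.lt_succ_self t) ρ hret

end Solo

/-! ### Splicing two runs -/

lemma Run.Legal.invokes {e : Run A} {T : ℕ} {v : V} {L : List ℕ} (h : e.Legal T v L) :
    ∀ a ∈ L, ∃ c op, e.ev a = .invoke c op := by
  induction L generalizing v with
  | nil => nofun
  | cons a l ih =>
    unfold Run.Legal at h
    have hl : (∃ c op, e.ev a = .invoke c op) ∧ ∃ w, e.Legal T w l := by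
      cases hx : e.ev a with
      | invoke c op =>
        rw [hx] at h
        cases op with
        | read => exact ⟨⟨c, _, rfl⟩, v, h.2⟩
        | write w => exact ⟨⟨c, _, rfl⟩, w, h.2⟩
      | _ => rw [hx] at h; exact h.elim
    obtain ⟨w, hw⟩ := hl.2
    intro b hb
    rcases List.mem_cons.1 hb with rfl | hb
    exacts [hl.1, ih hw b hb]

open Classical in
/-- The run that follows `e₁` before time `D`, without its crashes, and then follows `e₂`, with the
replicas in `B` not taking part, and those in `C` losing, when they restart, all that they have
stored in the first part. A replica whose storage has not changed cannot roll back, but then a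
restart has the same effect. -/
noncomputable def splice (e₁ e₂ : Run A) (D : ℕ) (B C : Finset (Fin n)) : Run A where
  clients := {0, 1}
  rep t i :=
    if t ≤ D then e₁.rep t i
    else if i ∈ B ∨ i ∈ C ∧ t - D ≤ n + i then e₁.rep D i else e₂.rep (t - D) i
  cl t c := if t ≤ D then e₁.cl t c else if c = 1 then e₂.cl (t - D) c else e₁.cl D c
  ev t :=
    if t < D then
      match e₁.ev t with
      | .crash _ => .idle
      | x => x
    else
      match e₂.ev (t - D) with
      | .crash (.replica i) => if i ∈ C then .crash (.replica i) else .idle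
      | .restart i => if (e₁.rep D i).2 = (e₁.rep 0 i).2 then .restart i else .rollback i 0
      | .deliver s j => .deliver (s + D) j
      | x => x
  sent t := if t < D then e₁.sent t else e₂.sent (t - D)
  resp t := if t < D then e₁.resp t else e₂.resp (t - D)

/-- The situation of the lower bound: in `e₁` client `0` writes `v` while the replicas in `X` have
crashed, and in `e₂` client `1` reads while those in `B` have crashed and those in `C` have
restarted. -/
structure Spliceable (e₁ e₂ : Run A) (v : V) (D : ℕ) (X B C : Finset (Fin n)) : Prop where
  exec₁ : e₁.IsExecution
  exec₂ : e₂.IsExecution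
  solo₁ : Solo e₁ 0 (.write v) X ∅
  solo₂ : Solo e₂ 1 .read B C
  cover : ∀ i, i ∈ X ∨ i ∈ B ∨ i ∈ C
  lt : 2 * n < D

namespace Spliceable

variable {e₁ e₂ : Run A} {v : V} {D : ℕ} {X B C : Finset (Fin n)}

lemma rep_early {t : ℕ} (ht : t ≤ D) : (splice e₁ e₂ D B C).rep t = e₁.rep t := by
  funext i; simp [splice, ht]

lemma cl_early {t : ℕ} (ht : t ≤ D) : (splice e₁ e₂ D B C).cl t = e₁.cl t := by
  funext i; simp [splice, ht]

lemma sent_early {t : ℕ} (ht : t < D) : (splice e₁ e₂ D B C).sent t = e₁.sent t := by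
  simp [splice, ht]

lemma resp_early {t : ℕ} (ht : t < D) : (splice e₁ e₂ D B C).resp t = e₁.resp t := by
  simp [splice, ht]

lemma sent_late (u : ℕ) : (splice e₁ e₂ D B C).sent (D + u) = e₂.sent u := by
  simp [splice]

lemma resp_late (u : ℕ) : (splice e₁ e₂ D B C).resp (D + u) = e₂.resp u := by
  simp [splice]

/-- At the seam, the replicas outside `B` and `C` are still in their initial states. -/
lemma rep_late (h : Spliceable e₁ e₂ v D X B C) (u : ℕ) (i : Fin n) :
    (splice e₁ e₂ D B C).rep (D + u) i =
      if i ∈ B ∨ i ∈ C ∧ u ≤ n + i then e₁.rep D i else e₂.rep u i := by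
  simp only [splice, Nat.add_sub_cancel_left]
  by_cases hu : D + u ≤ D
  · obtain rfl : u = 0 := by omega
    rw [if_pos hu]
    split_ifs with hc
    · rfl
    · have hX : i ∈ X := by
        rcases h.cover i with hX | hB | hC
        · exact hX
        · exact (hc (Or.inl hB)).elim
        · exact (hc (Or.inr ⟨hC, by omega⟩)).elim
      rw [Nat.add_zero, h.solo₁.rep_crashed h.exec₁ hX, h.exec₂.1]
  · rw [if_neg hu]

lemma cl_late (h : Spliceable e₁ e₂ v D X B C) (u c : ℕ) :
    (splice e₁ e₂ D B C).cl (D + u) c = if c = 1 then e₂.cl u c else e₁.cl D c := by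
  simp only [splice, Nat.add_sub_cancel_left]
  by_cases hu : D + u ≤ D
  · obtain rfl : u = 0 := by omega
    rw [if_pos hu]
    split_ifs with hc
    · rw [Nat.add_zero, h.solo₁.cl_other h.exec₁ (by omega), h.exec₂.2.1]
    · rfl
  · rw [if_neg hu]

lemma ev_early {t : ℕ} (ht : t < D) : (splice e₁ e₂ D B C).ev t =
    match e₁.ev t with | .crash _ => .idle | x => x := by
  simp [splice, ht]

open Classical in
lemma ev_late (u : ℕ) : (splice e₁ e₂ D B C).ev (D + u) =
    match e₂.ev u with
    | .crash (.replica i) => if i ∈ C then .crash (.replica i) else .idle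
    | .restart i => if (e₁.rep D i).2 = (e₁.rep 0 i).2 then .restart i else .rollback i 0
    | .deliver s j => .deliver (s + D) j
    | x => x := by
  simp only [splice, Nat.add_sub_cancel_left]
  rw [if_neg (by omega)]

lemma crash_spec (h : Spliceable e₁ e₂ v D X B C) {t : ℕ} {p : Proc n}
    (hx : (splice e₁ e₂ D B C).ev t = .crash p) : ∃ i ∈ C, p = .replica i ∧ t = D + i := by
  rcases lt_or_ge t D with ht | ht
  · rw [ev_early ht] at hx
    split at hx
    · cases hx
    · next h' => exact (h' _ hx).elim
  · obtain ⟨u, rfl⟩ := Nat.exists_eq_add_of_le ht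
    rw [ev_late] at hx
    split at hx
    · next i hu =>
      split_ifs at hx with hi
      cases hx
      obtain ⟨i', rfl, -, h1⟩ := h.solo₂.of_crash hu
      cases h1
      exact ⟨i, hi, rfl, rfl⟩
    · split_ifs at hx
    · cases hx
    · next h1 h2 h3 =>
      obtain ⟨i', -, -, rfl⟩ := h.solo₂.of_crash hx
      exact (h1 _ hx).elim

lemma restartsAt_spec (h : Spliceable e₁ e₂ v D X B C) {t : ℕ} {p : Proc n}
    (hx : (splice e₁ e₂ D B C).RestartsAt p t) : ∃ i ∈ C, p = .replica i ∧ t = D + (n + i) := by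
  obtain ⟨i, rfl, hx⟩ := hx
  refine ⟨i, ?_⟩
  rcases lt_or_ge t D with ht | ht
  · rw [ev_early ht] at hx
    rcases hx with hx | ⟨s, hx⟩
    · split at hx
      · cases hx
      · exact (Finset.notMem_empty _ (h.solo₁.of_restart hx).2).elim
    · split at hx
      · cases hx
      · exact (h.solo₁.not_rollback hx).elim
  · obtain ⟨u, rfl⟩ := Nat.exists_eq_add_of_le ht
    rw [ev_late] at hx
    split at hx
    · split_ifs at hx <;> rcases hx with hx | ⟨s, hx⟩ <;> cases hx
    · next i' hu =>
      obtain ⟨rfl, hC⟩ := h.solo₂.of_restart hu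
      split_ifs at hx <;> rcases hx with hx | ⟨s, hx⟩ <;> cases hx <;> exact ⟨hC, rfl, rfl⟩
    · rcases hx with hx | ⟨s, hx⟩ <;> cases hx
    · next h1 h2 h3 =>
      rcases hx with hx | ⟨s, hx⟩
      · exact (h2 _ hx).elim
      · exact (h.solo₂.not_rollback hx).elim

lemma restartsAt (h : Spliceable e₁ e₂ v D X B C) {i : Fin n} (hi : i ∈ C) :
    (splice e₁ e₂ D B C).RestartsAt (.replica i) (D + (n + i)) := by
  refine ⟨i, rfl, ?_⟩
  rw [ev_late, h.solo₂.restart, if_pos hi]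
  dsimp only
  split_ifs
  exacts [Or.inl rfl, Or.inr ⟨0, rfl⟩]

lemma invoke_spec (h : Spliceable e₁ e₂ v D X B C) {t c : ℕ} {op : RegOp V}
    (hx : (splice e₁ e₂ D B C).ev t = .invoke c op) :
    t = 2 * n ∧ c = 0 ∧ op = .write v ∨ t = D + 2 * n ∧ c = 1 ∧ op = .read := by
  rcases lt_or_ge t D with ht | ht
  · rw [ev_early ht] at hx
    split at hx
    · cases hx
    · exact Or.inl (h.solo₁.of_invoke hx)
  · obtain ⟨u, rfl⟩ := Nat.exists_eq_add_of_le ht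
    rw [ev_late] at hx
    split at hx
    · split_ifs at hx
    · split_ifs at hx
    · cases hx
    · obtain ⟨rfl, h1⟩ := h.solo₂.of_invoke hx
      exact Or.inr ⟨rfl, h1⟩

lemma upAt_client (h : Spliceable e₁ e₂ v D X B C) (c t : ℕ) :
    (splice e₁ e₂ D B C).UpAt (.client c) t := by
  rintro ⟨t', -, h1, -⟩
  obtain ⟨i, -, h2, -⟩ := h.crash_spec h1
  cases h2

lemma upAt_replica (h : Spliceable e₁ e₂ v D X B C) {i : Fin n} {t : ℕ}
    (ht : i ∈ C → t ≤ D + i ∨ D + (n + i) < t) :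
    (splice e₁ e₂ D B C).UpAt (.replica i) t := by
  rintro ⟨t', ht', h1, h2⟩
  obtain ⟨i', hi, h3, rfl⟩ := h.crash_spec h1
  cases h3
  rcases ht hi with h4 | h4
  · omega
  · exact h2 _ (by have := i.2; omega) h4 (h.restartsAt hi)

lemma downAt_restart (h : Spliceable e₁ e₂ v D X B C) {i : Fin n} (hi : i ∈ C) :
    (splice e₁ e₂ D B C).DownAt (.replica i) (D + (n + i)) := by
  refine ⟨D + i, by have := i.2; omega, ?_, fun s _ hs hr => ?_⟩
  · rw [ev_late, h.solo₂.crash, if_pos (Finset.mem_union_right _ hi)]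
    simp [hi]
  · obtain ⟨i', -, h1, h2⟩ := h.restartsAt_spec hr
    cases h1
    omega

lemma acts_early {t : ℕ} (ht : t < D) {p : Proc n} {inp : Input n A.Msg} (ha : e₁.Acts t p inp) :
    (splice e₁ e₂ D B C).Acts t p inp := by
  cases p <;>
  · unfold Run.Acts at ha ⊢
    rwa [rep_early (by omega), rep_early (by omega), cl_early (by omega), cl_early (by omega),
      sent_early ht, resp_early ht]

lemma acts_late (h : Spliceable e₁ e₂ v D X B C) {u : ℕ} (hu : 2 * n < u) {p : Proc n}
    {inp : Input n A.Msg} (hp : Active 1 B p) (ha : e₂.Acts u p inp) :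
    (splice e₁ e₂ D B C).Acts (D + u) p inp := by
  have hrep : ∀ u', 2 * n < u' → ∀ i, (splice e₁ e₂ D B C).rep (D + u') i =
      if i ∈ B then e₁.rep D i else e₂.rep u' i := fun u' hu' i => by
    have : ¬ (u' ≤ n + i) := by have := i.2; omega
    rw [h.rep_late]; simp [this]
  cases p with
  | replica i =>
    obtain ⟨st, out, hm, h1, h2, h3, h4⟩ := ha
    have hi : i ∉ B := hp
    refine ⟨st, out, ?_, ?_, ?_, by rw [sent_late, h3], by rw [resp_late, h4]⟩
    · rw [hrep u hu, if_neg hi]; exact hm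
    · funext j
      rw [add_assoc, hrep _ (by omega)]
      by_cases hj : j = i
      · subst hj
        rw [if_neg hi, h1, Function.update_self, Function.update_self]
      · rw [Function.update_of_ne hj, hrep u hu, h1, Function.update_of_ne hj]
    · funext c
      rw [add_assoc, h.cl_late, h.cl_late, h2]
  | client c =>
    obtain ⟨st, out, ρ, hm, h1, h2, h3, h4⟩ := ha
    obtain rfl : c = 1 := hp
    refine ⟨st, out, ρ, ?_, ?_, ?_, by rw [sent_late, h3], by rw [resp_late, h4]⟩
    · rw [h.cl_late, if_pos rfl]; exact hm
    · funext j
      rw [add_assoc, hrep _ (by omega), hrep _ hu, h1]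
    · funext c
      rw [add_assoc, h.cl_late, h2]
      by_cases hc : c = 1
      · subst hc; simp
      · rw [if_neg hc, Function.update_of_ne hc, h.cl_late, if_neg hc]

lemma quiet_late (h : Spliceable e₁ e₂ v D X B C) {u : ℕ} (hq : e₂.Quiet u) :
    (splice e₁ e₂ D B C).Quiet (D + u) := by
  refine ⟨?_, by rw [sent_late, hq.2.1], by rw [resp_late, hq.2.2]⟩
  funext c
  rw [add_assoc, h.cl_late, h.cl_late, hq.1]

lemma rep_late_succ (h : Spliceable e₁ e₂ v D X B C) {u : ℕ} {j : Fin n}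
    (hu : j ∈ C → u ≠ n + j) (hr : e₂.rep (u + 1) j = e₂.rep u j) :
    (splice e₁ e₂ D B C).rep (D + u + 1) j = (splice e₁ e₂ D B C).rep (D + u) j := by
  rw [add_assoc, h.rep_late, h.rep_late, hr]
  have : (j ∈ B ∨ j ∈ C ∧ u + 1 ≤ n + j) ↔ (j ∈ B ∨ j ∈ C ∧ u ≤ n + j) := by
    refine or_congr_right (and_congr_right fun hj => ?_)
    have := hu hj
    omega
  simp only [this]

lemma validStep_early (h : Spliceable e₁ e₂ v D X B C) {t : ℕ} (ht : t < D) :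
    (splice e₁ e₂ D B C).ValidStep t := by
  have hv := h.exec₁.2.2 t
  have hev : (splice e₁ e₂ D B C).ev t = _ := ev_early ht
  have hup : ∀ p, (splice e₁ e₂ D B C).UpAt p t := fun p => by
    cases p with
    | client c => exact h.upAt_client c t
    | replica i => exact h.upAt_replica fun _ => Or.inl (by omega)
  have hpres : ∀ {p}, Active 0 X p → (splice e₁ e₂ D B C).Present p := fun {p} hp => by
    cases p with
    | replica i => trivial
    | client c =>
      obtain rfl : c = 0 := hp
      simp [Run.Present, splice]
  have hquiet : e₁.rep (t + 1) = e₁.rep t → e₁.Quiet t →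
      (splice e₁ e₂ D B C).rep (t + 1) = (splice e₁ e₂ D B C).rep t ∧
        (splice e₁ e₂ D B C).Quiet t := by
    intro h1 h2
    unfold Run.Quiet
    rw [rep_early (by omega), rep_early (by omega), cl_early (by omega), cl_early (by omega),
      sent_early ht, resp_early ht]
    exact ⟨h1, h2⟩
  unfold Run.ValidStep at hv ⊢
  rw [hev]
  cases hx : e₁.ev t with
  | idle => rw [hx] at hv; exact hquiet hv.1 hv.2
  | crash p => rw [hx] at hv; exact hquiet hv.2.2.1 hv.2.2.2
  | rollback i s => exact (h.solo₁.not_rollback hx).elim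
  | restart i => exact (Finset.notMem_empty _ (h.solo₁.of_restart hx).2).elim
  | tick p =>
    rw [hx] at hv
    exact ⟨hpres (h.solo₁.of_tick hx).2, hup _, acts_early ht hv.2.2⟩
  | deliver s j =>
    rw [hx] at hv
    obtain ⟨h1, pk, hpk, h2⟩ := h.solo₁.of_deliver hx
    obtain ⟨pk', hs, hpk', hno, -, -, ha⟩ := hv
    rw [hpk] at hpk'
    cases hpk'
    refine ⟨pk, hs, by rw [sent_early (by omega)]; exact hpk, fun t' ht' h' => ?_, hpres h2,
      hup _, acts_early ht ha⟩
    rw [ev_early (by omega)] at h'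
    split at h'
    · cases h'
    · exact hno t' ht' h'
  | invoke c op =>
    rw [hx] at hv
    obtain ⟨rfl, rfl, rfl⟩ := h.solo₁.of_invoke hx
    obtain ⟨-, -, -, st, out, h1⟩ := hv
    refine ⟨by simp [splice], hup _, ?_, st, out, ?_⟩
    · rintro ⟨t', ht', ⟨op, h'⟩, -⟩
      rcases h.invoke_spec h' with h'' | h'' <;> omega
    · rwa [rep_early (by omega), rep_early (by omega), cl_early (by omega), cl_early (by omega),
        sent_early ht, resp_early ht]

lemma validStep_late (h : Spliceable e₁ e₂ v D X B C) (u : ℕ) :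
    (splice e₁ e₂ D B C).ValidStep (D + u) := by
  have hv := h.exec₂.2.2 u
  have hev : (splice e₁ e₂ D B C).ev (D + u) = _ := ev_late u
  have hup : ∀ {p}, 2 * n ≤ u → (splice e₁ e₂ D B C).UpAt p (D + u) := fun {p} hu => by
    cases p with
    | client c => exact h.upAt_client c _
    | replica i => exact h.upAt_replica fun _ => Or.inr (by have := i.2; omega)
  have hpres : ∀ {p}, Active 1 B p → (splice e₁ e₂ D B C).Present p := fun {p} hp => by
    cases p with
    | replica i => trivial
    | client c =>
      obtain rfl : c = 1 := hp
      simp [Run.Present, splice]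
  have hrep : (∀ i, e₂.ev u ≠ .restart i) → e₂.rep (u + 1) = e₂.rep u →
      (splice e₁ e₂ D B C).rep (D + u + 1) = (splice e₁ e₂ D B C).rep (D + u) := by
    intro hne hr
    funext j
    refine h.rep_late_succ (fun hj hu => ?_) (by rw [hr])
    refine hne j ?_
    rw [hu, h.solo₂.restart, if_pos hj]
  unfold Run.ValidStep at hv ⊢
  rw [hev]
  cases hx : e₂.ev u with
  | idle => rw [hx] at hv; exact ⟨hrep (by simp [hx]) hv.1, h.quiet_late hv.2⟩
  | rollback i s => exact (h.solo₂.not_rollback hx).elim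
  | crash p =>
    rw [hx] at hv
    obtain ⟨i, rfl, hi, rfl⟩ := h.solo₂.of_crash hx
    have h1 := hrep (by simp [hx]) hv.2.2.1
    have h2 := h.quiet_late hv.2.2.2
    dsimp only
    split_ifs
    · exact ⟨trivial, h.upAt_replica fun _ => Or.inl le_rfl, h1, h2⟩
    · exact ⟨h1, h2⟩
  | restart i =>
    rw [hx] at hv
    obtain ⟨rfl, hi⟩ := h.solo₂.of_restart hx
    obtain ⟨-, h1, st, hst, h2⟩ := hv
    have hB : i ∉ B := fun hB => Finset.disjoint_left.1 h.solo₂.disjoint hB hi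
    have hst0 : (e₂.rep (n + i) i).2 = (e₁.rep 0 i).2 := by
      rw [h.solo₂.rep_restarting h.exec₂ le_rfl, h.exec₁.1]
    have hD : (splice e₁ e₂ D B C).rep (D + (n + i)) i = e₁.rep D i := by
      rw [h.rep_late, if_pos (Or.inr ⟨hi, le_rfl⟩)]
    have hrep' : (splice e₁ e₂ D B C).rep (D + (n + i) + 1) =
        Function.update ((splice e₁ e₂ D B C).rep (D + (n + i))) i st := by
      funext j
      by_cases hj : j = i
      · subst hj
        rw [Function.update_self, add_assoc, h.rep_late, if_neg, h2, Function.update_self]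
        rintro (h3 | ⟨-, h3⟩)
        · exact hB h3
        · omega
      · rw [Function.update_of_ne hj]
        refine h.rep_late_succ (fun _ hu => hj (Fin.ext (by omega))) ?_
        rw [h2, Function.update_of_ne hj]
    dsimp only
    split_ifs with hc
    · exact ⟨h.downAt_restart hi, h.quiet_late h1, st, by rw [hD, hc, ← hst0]; exact hst, hrep'⟩
    · refine ⟨h.downAt_restart hi, h.quiet_late h1, by have := h.lt; omega, ?_, st, ?_, hrep'⟩
      · rw [rep_early (Nat.zero_le D), hD]
        exact fun h3 => hc h3.symm
      · rw [rep_early (Nat.zero_le D), ← hst0]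
        exact hst
  | tick p =>
    rw [hx] at hv
    obtain ⟨h1, h2⟩ := h.solo₂.of_tick hx
    exact ⟨hpres h2, hup h1.le, h.acts_late h1 h2 hv.2.2⟩
  | deliver s j =>
    rw [hx] at hv
    obtain ⟨h1, pk, hpk, h2⟩ := h.solo₂.of_deliver hx
    obtain ⟨pk', hs, hpk', hno, -, -, ha⟩ := hv
    rw [hpk] at hpk'
    cases hpk'
    refine ⟨pk, by omega, by rw [add_comm, sent_late]; exact hpk, fun t' ht' h' => ?_, hpres h2,
      hup h1.le, h.acts_late h1 h2 ha⟩
    rcases lt_or_ge t' D with htD | htD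
    · rw [ev_early htD] at h'
      split at h'
      · cases h'
      · -- in the first part, only messages of the first part are delivered
        have hv' := h.exec₁.2.2 t'
        unfold Run.ValidStep at hv'
        rw [h'] at hv'
        obtain ⟨_, hs', -⟩ := hv'
        omega
    · obtain ⟨u', rfl⟩ := Nat.exists_eq_add_of_le htD
      rw [ev_late] at h'
      split at h'
      · split_ifs at h'
      · split_ifs at h'
      · next s' j' hu' =>
        simp only [Event.deliver.injEq] at h'
        obtain ⟨h3, rfl⟩ := h'
        obtain rfl : s' = s := by omega
        exact hno u' (by omega) hu'
      · next h3 => exact (h3 _ _ h').elim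
  | invoke c op =>
    rw [hx] at hv
    have hx' := hx
    obtain ⟨rfl, rfl, rfl⟩ := h.solo₂.of_invoke hx
    obtain ⟨-, -, -, st, out, h1, h2, h3, h4, h5⟩ := hv
    refine ⟨by simp [splice], hup le_rfl, ?_, st, out, ?_, hrep (by simp [hx]) h2, ?_,
      by rw [sent_late, h4], by rw [resp_late, h5]⟩
    · rintro ⟨t', ht', ⟨op, h'⟩, -⟩
      rcases h.invoke_spec h' with h'' | h'' <;> omega
    · rw [h.cl_late, if_pos rfl]; exact h1
    · funext c
      rw [add_assoc, h.cl_late, h3]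
      by_cases hc : c = 1
      · subst hc; simp
      · rw [if_neg hc, Function.update_of_ne hc, h.cl_late, if_neg hc]

lemma isExecution (h : Spliceable e₁ e₂ v D X B C) : (splice e₁ e₂ D B C).IsExecution := by
  refine ⟨by rw [rep_early (Nat.zero_le D), h.exec₁.1],
    by rw [cl_early (Nat.zero_le D), h.exec₁.2.1], fun t => ?_⟩
  rcases lt_or_ge t D with ht | ht
  · exact h.validStep_early ht
  · obtain ⟨u, rfl⟩ := Nat.exists_eq_add_of_le ht
    exact h.validStep_late u

/-- Only the replicas in `C` are faulty, and no others crash. -/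
lemma withinBounds (h : Spliceable e₁ e₂ v D X B C) {k r b : ℕ} (hk : C.card ≤ k)
    (hr : C.card ≤ r) (hb : C.card ≤ b) : (splice e₁ e₂ D B C).WithinBounds k r b := by
  have hF : {i | (splice e₁ e₂ D B C).Faulty i} ⊆ (C : Set (Fin n)) := by
    intro i hi
    by_contra hiC
    refine hi ⟨⟨0, fun t _ => h.upAt_replica fun hC => (hiC hC).elim⟩, ?_⟩
    rintro ⟨t, s, h1⟩
    obtain ⟨i', hi', h2, -⟩ := h.restartsAt_spec (p := .replica i) ⟨i, rfl, Or.inr ⟨s, h1⟩⟩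
    cases h2
    exact hiC hi'
  have key : ∀ {S : Set (Fin n)}, S ⊆ (C : Set (Fin n)) → S.ncard ≤ C.card := fun hS =>
    (Set.ncard_le_ncard hS).trans (Set.ncard_coe_finset C).le
  refine ⟨(key hF).trans hk, (key fun i hi => hF hi.1).trans hr, (key ?_).trans hb⟩
  rintro i ⟨-, t, h1⟩
  obtain ⟨i', hi', h2, -⟩ := h.crash_spec h1
  cases h2
  exact hi'

/-- The read of the second part does not see the write of the first part. -/
lemma not_atomic (h : Spliceable e₁ e₂ v D X B C) {v₀ : V} (hv : v ≠ v₀) {t₁ t₂ : ℕ}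
    {ρ : RegResp V} (h₁ : e₁.Returns (2 * n) t₁ ρ) (ht₁ : t₁ < D)
    (h₂ : e₂.Returns (2 * n) t₂ (.value v₀)) : ¬ (splice e₁ e₂ D B C).Atomic v₀ := by
  intro hat
  have hinv₁ : (splice e₁ e₂ D B C).ev (2 * n) = .invoke 0 (.write v) := by
    rw [ev_early h.lt, h.solo₁.invoke]
  have hinv₂ : (splice e₁ e₂ D B C).ev (D + 2 * n) = .invoke 1 .read := by
    rw [ev_late, h.solo₂.invoke]
  have hret₁ : (splice e₁ e₂ D B C).Returns (2 * n) t₁ ρ := by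
    obtain ⟨c, op, h1, h2, h3, h4⟩ := h₁
    obtain ⟨-, rfl, -⟩ := h.solo₁.of_invoke h1
    refine ⟨_, _, hinv₁, h2, by rw [resp_early ht₁]; exact h3, fun s hs hs' => ?_⟩
    rw [resp_early (by omega)]
    exact h4 s hs hs'
  have hret₂ : (splice e₁ e₂ D B C).Returns (D + 2 * n) (D + t₂) (.value v₀) := by
    obtain ⟨c, op, h1, h2, h3, h4⟩ := h₂
    obtain ⟨-, rfl, -⟩ := h.solo₂.of_invoke h1
    refine ⟨_, _, hinv₂, by omega, by rw [resp_late]; exact h3, fun s hs hs' => ?_⟩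
    obtain ⟨u, rfl⟩ := Nat.exists_eq_add_of_le (show D ≤ s by omega)
    rw [resp_late]
    exact h4 u (by omega) (by omega)
  obtain ⟨L, hN, -, hL, hP, hleg⟩ := hat.2 (D + t₂ + 1)
  have hmem₁ := hL _ t₁ (by omega) _ hret₁
  have hmem₂ := hL _ (D + t₂) (by omega) _ hret₂
  have hperm : L.Perm [2 * n, D + 2 * n] := by
    have := h.lt
    refine (List.perm_ext_iff_of_nodup hN (by simp; omega)).2 fun a => ⟨fun ha => ?_, fun ha => ?_⟩
    · obtain ⟨c, op, h1⟩ := hleg.invokes a ha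
      rcases h.invoke_spec h1 with ⟨h1, -⟩ | ⟨h1, -⟩ <;> simp [h1]
    · simp only [List.mem_cons, List.not_mem_nil, or_false] at ha
      rcases ha with rfl | rfl <;> assumption
  obtain ⟨a, b, rfl⟩ := List.length_eq_two.1 hperm.length_eq
  have hab : a = 2 * n ∧ b = D + 2 * n := by
    simp only [List.mem_cons, List.not_mem_nil, or_false] at hmem₁ hmem₂
    have := h.lt
    rcases hmem₁ with h1 | h1
    · exact ⟨h1.symm, by omega⟩
    · have h2 : a = D + 2 * n := by omega
      subst h1 h2
      rw [List.pairwise_pair] at hP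
      exact (hP ⟨t₁, ρ, hret₁, by omega⟩).elim
  obtain ⟨rfl, rfl⟩ := hab
  unfold Run.Legal at hleg
  rw [hinv₁] at hleg
  have h3 := hleg.2
  unfold Run.Legal at h3
  rw [hinv₂] at h3
  have h4 := h3.1 _ (by omega) _ hret₂
  cases h4
  exact hv rfl

end Spliceable

/-! ### Necessity of the bound -/

lemma card_filter_fin_le (n a b : ℕ) :
    (Finset.univ.filter fun i : Fin n => a ≤ i ∧ (i : ℕ) < b).card ≤ b - a := by
  rw [← Nat.card_Ico]
  refine Finset.card_le_card_of_injOn (fun i => (i : ℕ)) (fun i hi => ?_)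
    (fun i _ j _ h => Fin.ext h)
  simpa using hi

theorem not_kTolerant {k r b : ℕ} [Nontrivial V] (A : RegImpl n V) (v₀ : V)
    (hr : r ≤ k) (hn : n ≤ 2 * k + min b r) : ¬ A.KTolerant v₀ k r b := by
  intro hA
  obtain ⟨v, hv⟩ := exists_ne v₀
  let X : Finset (Fin n) := Finset.univ.filter fun i => 0 ≤ (i : ℕ) ∧ (i : ℕ) < k
  let B : Finset (Fin n) := Finset.univ.filter fun i => k ≤ (i : ℕ) ∧ (i : ℕ) < 2 * k
  let C : Finset (Fin n) := Finset.univ.filter fun i => 2 * k ≤ (i : ℕ) ∧ (i : ℕ) < n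
  have hX : X.card ≤ k := card_filter_fin_le n 0 k
  have hB : B.card ≤ k := (card_filter_fin_le n k (2 * k)).trans (by omega)
  have hC : C.card ≤ min b r := (card_filter_fin_le n (2 * k) n).trans (by omega)
  have hBC : Disjoint B C := by
    refine Finset.disjoint_left.2 fun i hi hi' => ?_
    simp only [B, C, Finset.mem_filter] at hi hi'
    omega
  obtain ⟨e₁, hexec₁, hfair₁, hs₁⟩ := exists_solo A 0 (.write v) X ∅ (Finset.disjoint_empty_right X)
  obtain ⟨e₂, hexec₂, hfair₂, hs₂⟩ := exists_solo A 1 .read B C hBC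
  obtain ⟨-, hw₁⟩ := hA e₁ hexec₁ (hs₁.withinBounds r hX (by simp))
  obtain ⟨hat₂, hw₂⟩ := hA e₂ hexec₂ (hs₂.withinBounds r hB (by omega))
  obtain ⟨t₁, ρ₁, hret₁⟩ := hw₁ hfair₁ 0 hs₁.correctClient _ _ hs₁.invoke
  obtain ⟨t₂, ρ₂, hret₂⟩ := hw₂ hfair₂ 1 hs₂.correctClient _ _ hs₂.invoke
  obtain rfl := hs₂.read_returns_initial hat₂ hret₂
  have hsp : Spliceable e₁ e₂ v (t₁ + 1) X B C := by
    refine ⟨hexec₁, hexec₂, hs₁, hs₂, fun i => ?_, ?_⟩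
    · simp only [X, B, C, Finset.mem_filter, Finset.mem_univ, true_and]
      omega
    · obtain ⟨_, _, _, h, _⟩ := hret₁
      omega
  exact hsp.not_atomic hv hret₁ (Nat.lt_succ_self _) hret₂
    (hA _ hsp.isExecution (hsp.withinBounds (by omega) (by omega) (by omega))).1

lemma RegImpl.KTolerant.anti {v₀ : V} {k r r' b b' : ℕ} (h : A.KTolerant v₀ k r b) (hr : r' ≤ r)
    (hb : b' ≤ b) : A.KTolerant v₀ k r' b' := fun e he hw =>
  h e he ⟨hw.1, hw.2.1.trans hr, hw.2.2.trans hb⟩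

end CRR

/-- An implementation may depend on the thresholds that are known, but has to be `k`-tolerant for all
values of those that are unknown. The three parts: only `r` unknown, only `b` unknown, both unknown. -/
theorem mainTheorem7 (n k : ℕ) (V : Type) [Nontrivial V] (v₀ : V) :
    (∀ b ≤ n,
      (∃ A : CRR.RegImpl n V, ∀ r ≤ k, A.KTolerant v₀ k r b) ↔ n ≥ 2 * k + min b k + 1) ∧
    (∀ r ≤ k,
      (∃ A : CRR.RegImpl n V, ∀ b ≤ n, A.KTolerant v₀ k r b) ↔ n ≥ 2 * k + min n r + 1) ∧
    ((∃ A : CRR.RegImpl n V, ∀ r ≤ k, ∀ b ≤ n, A.KTolerant v₀ k r b) ↔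
      n ≥ 2 * k + min n k + 1) := by
  -- the largest values of the unknown thresholds are the worst
  refine ⟨fun b hb => ⟨fun ⟨A, hA⟩ => ?_, fun h => ?_⟩, fun r hr => ⟨fun ⟨A, hA⟩ => ?_, fun h => ?_⟩,
    fun ⟨A, hA⟩ => ?_, fun h => ?_⟩
  · by_contra hn
    exact CRR.not_kTolerant A v₀ le_rfl (by omega) (hA k le_rfl)
  · obtain ⟨A, hA⟩ := CRR.exists_kTolerant n k k b V v₀ (by omega)
    exact ⟨A, fun r hr => hA.anti hr le_rfl⟩
  · by_contra hn
    exact CRR.not_kTolerant A v₀ hr (by omega) (hA n le_rfl)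
  · obtain ⟨A, hA⟩ := CRR.exists_kTolerant n k r n V v₀ (by omega)
    exact ⟨A, fun b hb => hA.anti le_rfl hb⟩
  · by_contra hn
    exact CRR.not_kTolerant A v₀ le_rfl (by omega) (hA k le_rfl n le_rfl)
  · obtain ⟨A, hA⟩ := CRR.exists_kTolerant n k k n V v₀ (by omega)
    exact ⟨A, fun r hr b hb => hA.anti hr hb⟩
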